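/- All systems are invertible probability measure-preserving systems $(X,\mathcal B,\mu,T)$ on standard Borel spaces. For a sequence $A=(t_n)_{n\ge 1}$ of non-negative integers and a finite measurable partition $\xi$ put $h^A(T,\xi)=\limsup_{n\to\infty}\frac1n H\big(\bigvee_{k=1}^n T^{-t_k}\xi\big)$, where $H$ is Shannon entropy, and let $h^A(T)=\sup_\xi h^A(T,\xi)$, the supremum being over all finite measurable partitions. The system is called a rank one system with tower heights $(h_n)_{n\ge 0}$ if there are integers $q_n\ge 2$ and $a_{n,i}\ge 0$ ($n\ge 0$, $1\le i\le q_n-1$) such that, with $a_n=\sum_{i=1}^{q_n-1}a_{n,i}$, one has $h_0=1$, $h_{n+1}=q_nh_n+a_n$ and $\sum_n a_n/h_{n+1}<\infty$, and measurable sets $F_n$, $F_{n,i}$ ($1\le i\le q_n$) and $C_{n,i,j}$ ($1\le i\le q_n-1$, $1\le j\le a_{n,i}$) such that for all $n$: (a) the sets $T^kF_n$, $0\le k\le h_n-1$, are pairwise disjoint; (b) $F_{n,1},\dots,F_{n,q_n}$ partition $F_n$, and $F_{n+1}=F_{n,1}$; (c) for $1\le i\le q_n-1$: $T^{h_n}F_{n,i}=C_{n,i,1}$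 if $a_{n,i}>0$ and $T^{h_n}F_{n,i}=F_{n,i+1}$ if $a_{n,i}=0$; moreover $TC_{n,i,j}=C_{n,i,j+1}$ for $1\le j<a_{n,i}$ and $TC_{n,i,j}=F_{n,i+1}$ for $j=a_{n,i}\ge 1$; (d) the towers approach the point partition: for every measurable set $B$ and every $\varepsilon>0$, for all sufficiently large $n$ there is a union $U$ of sets among $T^kF_n$, $0\le k\le h_n-1$, with $\mu(B\,\triangle\,U)<\varepsilon$. **Theorem.** (i) Let $\alpha,\beta>0$ with $\alpha\ge 1+1/\beta$ and let $A=(\lfloor n^\alpha\rfloor)_{n\ge1}$. Then there is a rank one system with tower heights $h_n$ such that $h^A(T)>0$ and $$\limsup_{n\to\infty}\frac{\log h_{n+1}}{h_n^{\beta}}<\infty .$$ (ii) Let $\alpha,\beta>0$ with $\alpha\ge 1/\beta$ and let $A=(\lfloor n(\log n)^\alpha\rfloor)_{n\ge1}$. Then there is a rank one system with tower heights $h_n$ such that $h^A(T)>0$ and $$\limsup_{n\to\infty}\frac{\log h_{n+1}}{e^{h_n^{\beta}}}<\infty .$$ -/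

import Mathlib

open MeasureTheory Filter Topology

noncomputable section

/-- Shannon entropy (natural logarithm) of the finite partition of `X` into the fibres of a map
`φ : X → ι`, where `ι` is finite: the sum of `-μ(P) log μ(P)` over the cells `P = φ⁻¹{i}`. -/
def partitionEntropy {X ι : Type*} [MeasurableSpace X] [Fintype ι] (μ : Measure X)
    (φ : X → ι) : ℝ :=
  ∑ i : ι, Real.negMulLog (μ.real (φ ⁻¹' {i}))

/-- Coding map of the join `⋁_{k=1}^n T^{-t_k} ξ`, where the partition `ξ` is given by its
coding map `φ`: the point `x` is sent to the word `φ(T^{t_1} x) ⋯ φ(T^{t_n} x)`. -/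
def sequenceCoding {X ι : Type*} (T : X → X) (t : ℕ → ℕ) (φ : X → ι) (n : ℕ) :
    X → (Fin n → ι) :=
  fun x k => φ (T^[t ((k : ℕ) + 1)] x)

/-- Sequence entropy `h^A(T, ξ)` along `A = (t_n)_{n ≥ 1}` with respect to the partition `ξ` into
the fibres of `φ`. -/
def sequenceEntropyPartition {X ι : Type*} [MeasurableSpace X] [Fintype ι] (μ : Measure X)
    (T : X → X) (t : ℕ → ℕ) (φ : X → ι) : EReal :=
  limsup (fun n : ℕ =>
    ((1 / (n : ℝ) * partitionEntropy μ (sequenceCoding T t φ n) : ℝ) : EReal)) atTop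

/-- Sequence entropy `h^A(T)` along `A = (t_n)_{n ≥ 1}`: the supremum of `h^A(T, ξ)` over all
finite measurable partitions `ξ`, each given by a measurable coding map `X → {0, …, m - 1}`. -/
def sequenceEntropy {X : Type*} [MeasurableSpace X] (μ : Measure X) (T : X → X)
    (t : ℕ → ℕ) : EReal :=
  ⨆ (m : ℕ) (φ : X → Fin m) (_ : Measurable φ), sequenceEntropyPartition μ T t φ

/-- Total number `a_n = ∑_{i=1}^{q_n - 1} a_{n,i}` of spacers added at step `n`. -/
def spacerCount (q : ℕ → ℕ) (a : ℕ → ℕ → ℕ) (n : ℕ) : ℕ :=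
  ∑ i ∈ Finset.Ico 1 (q n), a n i

/-- Tower heights: `h_0 = 1` and `h_{n+1} = q_n h_n + a_n`. -/
def towerHeight (q : ℕ → ℕ) (a : ℕ → ℕ → ℕ) : ℕ → ℕ
  | 0 => 1
  | n + 1 => q n * towerHeight q a n + spacerCount q a n

/-- `T` is obtained by cutting and stacking with stacking data `(q_n; a_{n,i})`. Here `F n` is the
base of the `n`-th tower, `G n i` (for `1 ≤ i ≤ q n`) are the slices of `F n`, and `C n i j`
(for `1 ≤ i < q n` and `1 ≤ j ≤ a n i`) is the `j`-th spacer level put above the `i`-th slice of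
the `n`-th tower. -/
structure IsCutAndStack {X : Type*} [MeasurableSpace X] (μ : Measure X) (T : X ≃ᵐ X)
    (q : ℕ → ℕ) (a : ℕ → ℕ → ℕ) (F : ℕ → Set X) (G : ℕ → ℕ → Set X)
    (C : ℕ → ℕ → ℕ → Set X) : Prop where
  two_le_q : ∀ n, 2 ≤ q n
  summable_spacers :
    Summable fun n : ℕ => (spacerCount q a n : ℝ) / (towerHeight q a (n + 1) : ℝ)
  measurable_base : ∀ n, MeasurableSet (F n)
  measurable_slice : ∀ n i, 1 ≤ i → i ≤ q n → MeasurableSet (G n i)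
  measurable_spacer : ∀ n i j, 1 ≤ i → i < q n → 1 ≤ j → j ≤ a n i → MeasurableSet (C n i j)
  /-- The levels `T^k F_n`, `0 ≤ k < h_n`, are pairwise disjoint. -/
  disjoint_levels : ∀ n k l, k < towerHeight q a n → l < towerHeight q a n → k ≠ l →
    Disjoint ((⇑T)^[k] '' F n) ((⇑T)^[l] '' F n)
  /-- The slices `F_{n,1}, …, F_{n,q_n}` partition the base `F_n`. -/
  slices_cover : ∀ n, ⋃ i ∈ Finset.Icc 1 (q n), G n i = F n
  slices_disjoint : ∀ n i j, 1 ≤ i → i ≤ q n → 1 ≤ j → j ≤ q n → i ≠ j →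
    Disjoint (G n i) (G n j)
  glue_slice : ∀ n i, 1 ≤ i → i < q n →
    (⇑T)^[towerHeight q a n] '' G n i = if 0 < a n i then C n i 1 else G n (i + 1)
  glue_spacer : ∀ n i j, 1 ≤ i → i < q n → 1 ≤ j → j ≤ a n i →
    ⇑T '' C n i j = if j < a n i then C n i (j + 1) else G n (i + 1)
  base_succ : ∀ n, F (n + 1) = G n 1
  /-- The towers converge to the point partition: every measurable set is, up to arbitrarily
  small measure, a union of levels of the `n`-th tower, for all large `n`. -/
  generating : ∀ B : Set X, MeasurableSet B → ∀ ε : ℝ, 0 < ε → ∀ᶠ n in atTop,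
    ∃ s : Finset ℕ, s ⊆ Finset.range (towerHeight q a n) ∧
      μ.real (symmDiff B (⋃ k ∈ s, (⇑T)^[k] '' F n)) < ε

/-- `(X, μ, T)` is a rank one system, that is, an invertible probability measure-preserving system
obtained by cutting and stacking, and `h` is the sequence of heights of its towers. -/
def IsRankOneSystem {X : Type*} [MeasurableSpace X] (μ : Measure X) (T : X ≃ᵐ X)
    (h : ℕ → ℕ) : Prop :=
  IsProbabilityMeasure μ ∧ MeasurePreserving T μ μ ∧
    ∃ (q : ℕ → ℕ) (a : ℕ → ℕ → ℕ) (F : ℕ → Set X) (G : ℕ → ℕ → Set X)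
      (C : ℕ → ℕ → ℕ → Set X),
      IsCutAndStack μ T q a F G C ∧ h = towerHeight q a

end

/-
The systems are skyscrapers over the 2-adic odometer `x ↦ x + 1` on `ℤ_[2]`, with an extra level
below each point of a spacer set. Let `M` be increasing with `M 0 = 0`, and let the spacer set
consist, for every `n`, of the classes `i * 2 ^ M n` modulo `2 ^ M (n + 1)` with
`0 < i < 2 ^ (M (n + 1) - M n)` and `A n i` true. The orbit of the class of `0` modulo `2 ^ M n` up
to its return is then the `n`-th tower of a rank one system, and `A n` tells where the spacers lie
when it is cut into `2 ^ (M (n + 1) - M n)` slices.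

Let `h` be the height of the `n`-th tower. For a pattern `A n` of the form
`c 0, !c 0, c 1, !c 1, …` the next tower consists of superblocks of the constant height `2 * h + 1`,
and the bit `c l` shows as a shift by one of the first copy of the `n`-th tower in the `l`-th
superblock. The bits `c` run through all binary words of length `2 * V`. Suppose that the times
`t (K + 4 * j)`, `j < K`, have gaps at least `2 * h + 1` and do not exceed the height of `V`
superblocks. From a typical level of the next tower, almost half of these times hit first copies,
in distinct superblocks, so that the coding along `t` determines that many bits. As these are
independent and uniform, the entropy up to `t (5 * K)` is at least `K * log 2 / 16`, while
`log h_{n+1}` is of the order of `V + log h`, and `V` of the order of `t (5 * K) / h` is enough.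

For `t k = ⌊k * g k⌋` the gaps allow to take `K` of the order of `g⁻¹(h)`, and so is then `V`. This
order is `h ^ (1 / (α - 1)) ≤ h ^ β` for `g x = x ^ (α - 1)`, and `exp (h ^ (1 / α)) ≤ exp (h ^ β)`
for `g x = (log x) ^ α`.
-/

namespace PadicSkyscraper

noncomputable section

section PadicResidues

variable {p : ℕ} [Fact p.Prime]

/-- The Borel σ-algebra of the `p`-adic integers. -/
instance padicMeasurableSpace : MeasurableSpace ℤ_[p] := borel _

instance padicBorelSpace : BorelSpace ℤ_[p] := ⟨rfl⟩

lemma toZModPow_eq_iff_norm_sub_le (m : ℕ) (x y : ℤ_[p]) :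
    PadicInt.toZModPow m x = PadicInt.toZModPow m y ↔ ‖x - y‖ ≤ (p : ℝ) ^ (-m : ℤ) := by
  rw [PadicInt.norm_le_pow_iff_mem_span_pow, ← PadicInt.ker_toZModPow, RingHom.mem_ker, map_sub,
    sub_eq_zero]

lemma isLocallyConstant_toZModPow (m : ℕ) : IsLocallyConstant (PadicInt.toZModPow (p := p) m) := by
  have hp : (0 : ℝ) < p := mod_cast (Fact.out : p.Prime).pos
  refine (IsLocallyConstant.iff_eventually_eq _).2 fun x => ?_
  filter_upwards [Metric.closedBall_mem_nhds x (zpow_pos hp (-m : ℤ))] with y hy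
  exact (toZModPow_eq_iff_norm_sub_le m y x).2 (mem_closedBall_iff_norm.1 hy)

lemma measurableSet_preimage_toZModPow (m : ℕ) (R : Set (ZMod (p ^ m))) :
    MeasurableSet (PadicInt.toZModPow m ⁻¹' R) :=
  (isLocallyConstant_toZModPow m R).measurableSet

/-- The cylinders: sets of `p`-adic integers determined by a residue modulo some power of `p`. -/
def padicCylinders (p : ℕ) [Fact p.Prime] : Set (Set ℤ_[p]) :=
  {B | ∃ m, ∃ R : Set (ZMod (p ^ m)), B = PadicInt.toZModPow m ⁻¹' R}

lemma exists_preimage_toZModPow_of_le {m n : ℕ} (h : m ≤ n) (R : Set (ZMod (p ^ m))) :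
    ∃ R' : Set (ZMod (p ^ n)), PadicInt.toZModPow m ⁻¹' R = PadicInt.toZModPow n ⁻¹' R' :=
  ⟨{r | (r.cast : ZMod (p ^ m)) ∈ R}, by
    ext x; simp only [Set.mem_preimage, Set.mem_ofPred_eq, PadicInt.cast_toZModPow m n h]⟩

lemma isSetRing_padicCylinders : IsSetRing (padicCylinders p) := by
  have common (s t) (hs : s ∈ padicCylinders p) (ht : t ∈ padicCylinders p) :
      ∃ n, ∃ R R' : Set (ZMod (p ^ n)),
        s = PadicInt.toZModPow n ⁻¹' R ∧ t = PadicInt.toZModPow n ⁻¹' R' := by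
    obtain ⟨m, R, rfl⟩ := hs
    obtain ⟨n, R', rfl⟩ := ht
    obtain ⟨R₁, h₁⟩ := exists_preimage_toZModPow_of_le (le_max_left m n) R
    obtain ⟨R₂, h₂⟩ := exists_preimage_toZModPow_of_le (le_max_right m n) R'
    exact ⟨max m n, R₁, R₂, h₁, h₂⟩
  refine ⟨⟨0, ∅, rfl⟩, fun s t hs ht => ?_, fun s t hs ht => ?_⟩ <;>
    obtain ⟨n, R, R', rfl, rfl⟩ := common s t hs ht
  · exact ⟨n, R ∪ R', rfl⟩
  · exact ⟨n, R \ R', rfl⟩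

lemma isTopologicalBasis_padicCylinders :
    TopologicalSpace.IsTopologicalBasis (padicCylinders p) := by
  refine TopologicalSpace.isTopologicalBasis_of_isOpen_of_nhds ?_ fun x U hx hU => ?_
  · rintro _ ⟨m, R, rfl⟩
    exact isLocallyConstant_toZModPow m R
  · have hp : 1 < (p : ℝ) := mod_cast (Fact.out : p.Prime).one_lt
    obtain ⟨ε, hε, hball⟩ := Metric.isOpen_iff.1 hU x hx
    obtain ⟨m, hm⟩ := exists_pow_lt_of_lt_one hε (inv_lt_one_of_one_lt₀ hp)
    refine ⟨_, ⟨m, {PadicInt.toZModPow m x}, rfl⟩, rfl, fun y hy => hball ?_⟩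
    refine mem_ball_iff_norm.2 (((toZModPow_eq_iff_norm_sub_le m y x).1 hy).trans_lt ?_)
    rwa [zpow_neg, zpow_natCast, ← inv_pow]

lemma exists_forall_ge_symmDiff_preimage_toZModPow_lt (ν : Measure ℤ_[p]) [IsFiniteMeasure ν]
    {B : Set ℤ_[p]} (hB : MeasurableSet B) {ε : ℝ} (hε : 0 < ε) :
    ∃ m₀, ∀ m ≥ m₀, ∃ R : Set (ZMod (p ^ m)),
      ν.real (symmDiff (PadicInt.toZModPow m ⁻¹' R) B) < ε := by
  obtain ⟨_, ⟨m₀, R₀, rfl⟩, h⟩ := exists_measure_symmDiff_lt_of_generateFrom_isSetRing (μ := ν)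
    isSetRing_padicCylinders
    ⟨{Set.univ}, Set.countable_singleton _, Set.singleton_subset_iff.2 ⟨0, Set.univ, rfl⟩, by simp⟩
    isTopologicalBasis_padicCylinders.borel_eq_generateFrom hB (ENNReal.ofReal_pos.2 hε)
  refine ⟨m₀, fun m hm => ?_⟩
  obtain ⟨R, hR⟩ := exists_preimage_toZModPow_of_le hm R₀
  exact ⟨R, hR ▸ ENNReal.toReal_lt_of_lt_ofReal h⟩

variable (p) in
/-- The normalized Haar measure of the `p`-adic integers. -/
def padicHaar : Measure ℤ_[p] := Measure.addHaarMeasure ⊤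

instance : IsProbabilityMeasure (padicHaar p) :=
  ⟨Measure.addHaarMeasure_self (K₀ := (⊤ : TopologicalSpace.PositiveCompacts ℤ_[p]))⟩

instance : (padicHaar p).IsAddLeftInvariant := by
  unfold padicHaar; infer_instance

lemma padicHaar_real_preimage_toZModPow_singleton (m : ℕ) (r : ZMod (p ^ m)) :
    (padicHaar p).real (PadicInt.toZModPow m ⁻¹' {r}) = ((p : ℝ) ^ m)⁻¹ := by
  have surj := ZMod.ringHom_surjective (PadicInt.toZModPow (p := p) m)
  let K : AddSubgroup ℤ_[p] := (PadicInt.toZModPow m : ℤ_[p] →+* ZMod (p ^ m)).toAddMonoidHom.ker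
  have index_K : K.index = p ^ m := by
    rw [AddSubgroup.index_ker, AddMonoidHom.range_eq_top.2 surj, AddSubgroup.card_top,
      Nat.card_zmod]
  have : K.FiniteIndex := ⟨by simp [index_K, (Fact.out : p.Prime).ne_zero]⟩
  have measure_K : (p : ℝ) ^ m * (padicHaar p).real K = 1 := by
    have h := K.index_mul_measure (measurableSet_preimage_toZModPow m {0}) (padicHaar p)
    simpa [index_K, measureReal_def] using congrArg ENNReal.toReal h
  obtain ⟨y, rfl⟩ := surj r
  have translate : (fun x => -y + x) ⁻¹' (K : Set ℤ_[p]) =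
      PadicInt.toZModPow m ⁻¹' {PadicInt.toZModPow m y} := by
    ext x
    simp [K, AddMonoidHom.mem_ker, neg_add_eq_zero, eq_comm (a := PadicInt.toZModPow m y)]
  rw [← translate, measureReal_def, measure_preimage_add, ← measureReal_def]
  exact eq_inv_of_mul_eq_one_right measure_K

end PadicResidues

section Skyscraper

variable {Y : Type*}

/-- The two-storey skyscraper over `S : Y → Y`, as a self-map of `Y × Bool`. For `y ∈ E` the
spacer `(y, true)` is visited just before `(y, false)`; for `y ∉ E` the point `(y, true)` is fixed
and does not belong to the skyscraper, see `skyscraperDomain`. -/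
def skyscraperStep (S : Y → Y) (E : Set Y) (x : Y × Bool) : Y × Bool :=
  if x.2 then (x.1, !E.boolIndicator x.1) else (S x.1, E.boolIndicator (S x.1))

/-- The points of `Y × Bool` that belong to the skyscraper. -/
def skyscraperDomain (E : Set Y) : Set (Y × Bool) := {x | x.2 = true → x.1 ∈ E}

@[simp]
lemma skyscraperStep_false (S : Y → Y) (E : Set Y) (y : Y) :
    skyscraperStep S E (y, false) = (S y, E.boolIndicator (S y)) := rfl

@[simp]
lemma skyscraperStep_true (S : Y → Y) (E : Set Y) (y : Y) :
    skyscraperStep S E (y, true) = (y, !E.boolIndicator y) := rfl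

lemma mem_skyscraperDomain {E : Set Y} {x : Y × Bool} :
    x ∈ skyscraperDomain E ↔ (x.2 = true → x.1 ∈ E) := Iff.rfl

lemma skyscraperStep_mem_domain_iff (S : Y → Y) (E : Set Y) (x : Y × Bool) :
    skyscraperStep S E x ∈ skyscraperDomain E ↔ x ∈ skyscraperDomain E := by
  obtain ⟨y, _ | _⟩ := x
  · simp [mem_skyscraperDomain, Set.mem_iff_boolIndicator E (S y)]
  · cases h : E.boolIndicator y <;>
      simp [mem_skyscraperDomain, Set.mem_iff_boolIndicator E y, h]

variable [MeasurableSpace Y]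

lemma measurable_boolIndicator {E : Set Y} (hE : MeasurableSet E) : Measurable E.boolIndicator :=
  measurable_to_bool (by rwa [Set.preimage_boolIndicator_true])

lemma measurable_skyscraperStep {S : Y → Y} (hS : Measurable S) {E : Set Y}
    (hE : MeasurableSet E) : Measurable (skyscraperStep S E) := by
  have hE' := measurable_boolIndicator hE
  refine measurable_from_prod_countable_left fun b => ?_
  cases b
  · exact hS.prodMk (hE'.comp hS)
  · exact measurable_id.prodMk ((measurable_of_countable Bool.not).comp hE')

/-- The skyscraper over an automorphism of `Y`, as an automorphism of `Y × Bool`. -/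
def skyscraper (S : Y ≃ᵐ Y) {E : Set Y} (hE : MeasurableSet E) : Y × Bool ≃ᵐ Y × Bool where
  toFun := skyscraperStep S E
  invFun x := if x.2 = E.boolIndicator x.1 then (S.symm x.1, false) else (x.1, true)
  left_inv := by rintro ⟨y, _ | _⟩ <;> simp
  right_inv := by
    rintro ⟨y, b⟩
    by_cases h : b = E.boolIndicator y
    · simp [h]
    · simp [Bool.eq_not_of_ne h]
  measurable_toFun := measurable_skyscraperStep S.measurable hE
  measurable_invFun :=
    Measurable.ite (measurableSet_eq_fun measurable_snd
        ((measurable_boolIndicator hE).comp measurable_fst))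
      ((S.symm.measurable.comp measurable_fst).prodMk measurable_const)
      (measurable_fst.prodMk measurable_const)

lemma coe_skyscraper (S : Y ≃ᵐ Y) {E : Set Y} (hE : MeasurableSet E) :
    ⇑(skyscraper S hE) = skyscraperStep S E := rfl

lemma measurableSet_skyscraperDomain {E : Set Y} (hE : MeasurableSet E) :
    MeasurableSet (skyscraperDomain E) := by
  have : skyscraperDomain E = (Set.univ ×ˢ {true} \ E ×ˢ Set.univ)ᶜ := by
    ext x; simp [skyscraperDomain]
  rw [this]
  measurability

variable (ν : Measure Y)

/-- The normalized restriction of `ν × count` to the skyscraper. -/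
def skyscraperMeasure (E : Set Y) : Measure (Y × Bool) :=
  ProbabilityTheory.cond (ν.prod Measure.count) (skyscraperDomain E)

variable {ν} in
lemma prod_count_bool_apply [SFinite ν] {B : Set (Y × Bool)} (hB : MeasurableSet B) :
    ν.prod Measure.count B = ν {y | (y, false) ∈ B} + ν {y | (y, true) ∈ B} := by
  rw [Measure.prod_apply_symm hB, lintegral_count, tsum_bool]
  rfl

variable {ν} in
lemma measurePreserving_skyscraper_prod_count [SFinite ν] {S : Y ≃ᵐ Y}
    (hS : MeasurePreserving S ν ν) {E : Set Y} (hE : MeasurableSet E) :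
    MeasurePreserving (skyscraper S hE) (ν.prod .count) (ν.prod .count) := by
  refine ⟨(skyscraper S hE).measurable, Measure.ext fun B hB => ?_⟩
  have hE' := measurable_boolIndicator hE
  have measurable_slice {σ : Y → Bool} (hσ : Measurable σ) : MeasurableSet {y | (y, σ y) ∈ B} :=
    (measurable_id.prodMk hσ) hB
  rw [Measure.map_apply (skyscraper S hE).measurable hB, prod_count_bool_apply hB,
    prod_count_bool_apply ((skyscraper S hE).measurable hB)]
  calc ν (S ⁻¹' {y | (y, E.boolIndicator y) ∈ B}) + ν {y | (y, !E.boolIndicator y) ∈ B}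
      = ν {y | (y, E.boolIndicator y) ∈ B} + ν {y | (y, !E.boolIndicator y) ∈ B} := by
        rw [hS.measure_preimage (measurable_slice hE').nullMeasurableSet]
    _ = ν {y | (y, false) ∈ B} + ν {y | (y, true) ∈ B} := by
        have measurable_not : MeasurableSet {y | (y, !E.boolIndicator y) ∈ B} :=
          measurable_slice ((measurable_of_countable Bool.not).comp hE')
        rw [← measure_union_add_inter _ (measurable_slice measurable_const),
          ← measure_union_add_inter _ measurable_not]
        congr 2 <;> ext y <;> cases h : E.boolIndicator y <;> simp [h, or_comm, and_comm]

variable {ν} in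
lemma prod_count_skyscraperDomain [SFinite ν] {E : Set Y} (hE : MeasurableSet E) :
    ν.prod Measure.count (skyscraperDomain E) = ν Set.univ + ν E := by
  rw [prod_count_bool_apply (measurableSet_skyscraperDomain hE)]
  simp [mem_skyscraperDomain]

variable {ν} in
lemma measurePreserving_skyscraper [IsFiniteMeasure ν] {S : Y ≃ᵐ Y}
    (hS : MeasurePreserving S ν ν) {E : Set Y} (hE : MeasurableSet E) :
    MeasurePreserving (skyscraper S hE) (skyscraperMeasure ν E) (skyscraperMeasure ν E) := by
  have h := (measurePreserving_skyscraper_prod_count hS hE).restrict_preimage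
    (measurableSet_skyscraperDomain hE)
  have invariant : skyscraper S hE ⁻¹' skyscraperDomain E = skyscraperDomain E :=
    Set.ext (skyscraperStep_mem_domain_iff S E)
  rw [invariant] at h
  exact h.smul_measure _

instance [IsFiniteMeasure ν] [NeZero ν] (E : Set Y) :
    IsProbabilityMeasure (skyscraperMeasure ν E) := by
  refine ProbabilityTheory.cond_isProbabilityMeasure (pos_iff_ne_zero.1 ?_)
  calc 0 < ν.prod Measure.count (Set.univ ×ˢ {false}) := by
        simp [Measure.prod_prod, NeZero.ne ν, pos_iff_ne_zero]
    _ ≤ _ := measure_mono fun x hx => by simp_all [mem_skyscraperDomain]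

variable {ν} in
lemma skyscraperMeasure_real_apply [IsProbabilityMeasure ν] {E : Set Y} (hE : MeasurableSet E)
    {B : Set (Y × Bool)} (hB : MeasurableSet B) :
    (skyscraperMeasure ν E).real B =
      (1 + ν.real E)⁻¹ * (ν.real {y | (y, false) ∈ B} + ν.real ({y | (y, true) ∈ B} ∩ E)) := by
  have hD := measurableSet_skyscraperDomain hE
  have slice_false : {y | (y, false) ∈ skyscraperDomain E ∩ B} = {y | (y, false) ∈ B} := by
    ext y; simp [mem_skyscraperDomain]
  have slice_true : {y | (y, true) ∈ skyscraperDomain E ∩ B} = {y | (y, true) ∈ B} ∩ E := by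
    ext y; simp [mem_skyscraperDomain, and_comm]
  rw [skyscraperMeasure, measureReal_def, ProbabilityTheory.cond_apply hD, ENNReal.toReal_mul,
    ENNReal.toReal_inv, prod_count_skyscraperDomain hE, prod_count_bool_apply (hD.inter hB),
    slice_false, slice_true,
    ENNReal.toReal_add (measure_ne_top _ _) (measure_ne_top _ _),
    ENNReal.toReal_add (measure_ne_top _ _) (measure_ne_top _ _), measure_univ, ENNReal.toReal_one]
  rfl

end Skyscraper

section NatOrbit

variable (E : Set ℕ)

/-- The orbit of `(0, false)` in the skyscraper over the successor map of `ℕ`. -/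
def orbit (t : ℕ) : ℕ × Bool := (skyscraperStep Nat.succ E)^[t] (0, false)

/-- The time at which `orbit E` visits `(r, false)`. -/
def visitTime (r : ℕ) : ℕ := ∑ s ∈ Finset.range r, (1 + (E.boolIndicator (s + 1)).toNat)

/-- The number of steps that `orbit E` takes from `(0, false)` to `(Q - 1, false)`, both included:
the height of the tower whose levels are indexed by `0, …, Q - 1` and the spacers in between. -/
def orbitHeight (Q : ℕ) : ℕ := visitTime E (Q - 1) + 1

lemma orbit_succ (t : ℕ) : orbit E (t + 1) = skyscraperStep Nat.succ E (orbit E t) :=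
  Function.iterate_succ_apply' _ _ _

lemma visitTime_add (a b : ℕ) : visitTime E (a + b) =
    visitTime E a + ∑ s ∈ Finset.range b, (1 + (E.boolIndicator (a + s + 1)).toNat) :=
  Finset.sum_range_add _ _ _

lemma visitTime_succ (r : ℕ) :
    visitTime E (r + 1) = visitTime E r + 1 + (E.boolIndicator (r + 1)).toNat := by
  rw [visitTime, Finset.sum_range_succ, ← add_assoc, visitTime]

lemma strictMono_visitTime : StrictMono (visitTime E) :=
  strictMono_nat_of_lt_succ fun r => by rw [visitTime_succ]; omega

lemma le_orbitHeight (Q : ℕ) : Q ≤ orbitHeight E Q :=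
  Nat.le_add_of_sub_le (strictMono_visitTime E).le_apply

lemma orbit_visitTime (r : ℕ) : orbit E (visitTime E r) = (r, false) := by
  induction r with
  | zero => rfl
  | succ r ih =>
    cases h : E.boolIndicator (r + 1) <;>
      simp [visitTime_succ, h, orbit_succ, ih]

lemma orbit_mem_skyscraperDomain (t : ℕ) : orbit E t ∈ skyscraperDomain E := by
  induction t with
  | zero => simp [orbit, mem_skyscraperDomain]
  | succ t ih => rwa [orbit_succ, skyscraperStep_mem_domain_iff]

lemma visitTime_orbit (t : ℕ) : visitTime E (orbit E t).1 = t + (orbit E t).2.toNat := by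
  induction t with
  | zero => rfl
  | succ t ih =>
    have mem_E := orbit_mem_skyscraperDomain E t
    rw [orbit_succ]
    generalize orbit E t = x at ih mem_E ⊢
    obtain ⟨r, _ | _⟩ := x
    · rw [skyscraperStep_false, Nat.succ_eq_add_one, visitTime_succ, ih, Bool.toNat_false, add_zero]
    · have : E.boolIndicator r = true := (Set.mem_iff_boolIndicator E r).1 (mem_E rfl)
      simp [this, ih]

lemma injective_orbit : Function.Injective (orbit E) := by
  intro t t' h
  have ht := visitTime_orbit E t
  have ht' := visitTime_orbit E t'
  rw [h] at ht
  omega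

lemma orbit_fst_pos_of_snd {t : ℕ} (ht : (orbit E t).2 = true) : 0 < (orbit E t).1 := by
  have h := visitTime_orbit E t
  refine Nat.pos_of_ne_zero fun h0 => ?_
  simp [h0, ht, visitTime] at h

lemma monotone_orbit_fst : Monotone fun t => (orbit E t).1 := by
  refine monotone_nat_of_le_succ fun t => ?_
  rw [orbit_succ]
  rcases orbit E t with ⟨r, _ | _⟩ <;> simp

variable {E}

lemma orbit_fst_lt {Q t : ℕ} (hQ : 0 < Q) (ht : t < orbitHeight E Q) : (orbit E t).1 < Q := by
  have : (orbit E t).1 ≤ (orbit E (visitTime E (Q - 1))).1 :=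
    monotone_orbit_fst E (Nat.le_of_lt_succ ht)
  rw [orbit_visitTime] at this
  omega

lemma iterate_skyscraperStep {Y : Type*} {S : Y → Y} {D : Set Y} {y : Y} {Q : ℕ}
    (hD : ∀ r, 0 < r → r < Q → (S^[r] y ∈ D ↔ r ∈ E)) (hQ : 0 < Q) {t : ℕ}
    (ht : t < orbitHeight E Q) :
    (skyscraperStep S D)^[t] (y, false) = (S^[(orbit E t).1] y, (orbit E t).2) := by
  have indicator_eq {r : ℕ} (h0 : 0 < r) (hr : r < Q) :
      D.boolIndicator (S^[r] y) = E.boolIndicator r := by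
    simpa only [Set.mem_iff_boolIndicator, Bool.coe_iff_coe] using hD r h0 hr
  induction t with
  | zero => rfl
  | succ t ih =>
    have fst_lt := orbit_fst_lt hQ (t.lt_succ_self.trans ht)
    have fst_succ_lt := orbit_fst_lt hQ ht
    have fst_pos := orbit_fst_pos_of_snd E (t := t)
    rw [Function.iterate_succ_apply', ih (t.lt_succ_self.trans ht)]
    rw [orbit_succ] at fst_succ_lt ⊢
    generalize orbit E t = x at fst_lt fst_succ_lt fst_pos ⊢
    obtain ⟨r, _ | _⟩ := x
    · simp only [skyscraperStep_false, ← Function.iterate_succ_apply' S]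
      rw [indicator_eq r.succ_pos fst_succ_lt]
    · simp only [skyscraperStep_true]
      rw [indicator_eq (fst_pos rfl) fst_lt]

lemma orbit_visitTime_add {a Q : ℕ} (ha : ∀ r, 0 < r → r < Q → (a + r ∈ E ↔ r ∈ E)) (hQ : 0 < Q)
    {t : ℕ} (ht : t < orbitHeight E Q) :
    orbit E (visitTime E a + t) = (a + (orbit E t).1, (orbit E t).2) := by
  have ha' : ∀ r, 0 < r → r < Q → (Nat.succ^[r] a ∈ E ↔ r ∈ E) := by
    simpa only [Nat.succ_iterate] using ha
  calc orbit E (visitTime E a + t)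
      = (skyscraperStep Nat.succ E)^[t] (orbit E (visitTime E a)) := by
        rw [orbit, add_comm, Function.iterate_add_apply, ← orbit]
    _ = (a + (orbit E t).1, (orbit E t).2) := by
        rw [orbit_visitTime, iterate_skyscraperStep ha' hQ ht, Nat.succ_iterate]

lemma orbitHeight_add {a Q : ℕ} (ha : ∀ r, 0 < r → r < Q → (a + r ∈ E ↔ r ∈ E)) (hQ : 0 < Q) :
    orbitHeight E (a + Q) = visitTime E a + orbitHeight E Q := by
  have indicator_eq {r : ℕ} (hr : r ∈ Finset.range (Q - 1)) :
      E.boolIndicator (a + r + 1) = E.boolIndicator (r + 1) := by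
    have hr' := Finset.mem_range.1 hr
    simpa only [Set.mem_iff_boolIndicator, Bool.coe_iff_coe, add_assoc] using
      ha (r + 1) r.succ_pos (by omega)
  rw [orbitHeight, orbitHeight, Nat.add_sub_assoc hQ, visitTime_add, ← add_assoc]
  congr 2
  exact Finset.sum_congr rfl fun r hr => by rw [indicator_eq hr]

lemma visitTime_eq_orbitHeight_add {r : ℕ} (hr : 0 < r) :
    visitTime E r = orbitHeight E r + (E.boolIndicator r).toNat := by
  obtain ⟨r, rfl⟩ := Nat.exists_eq_succ_of_ne_zero hr.ne'
  exact visitTime_succ E r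

lemma orbitHeight_mul {q Q : ℕ} (hq : 0 < q) (hQ : 0 < Q)
    (hE : ∀ i < q, ∀ r, 0 < r → r < Q → (i * Q + r ∈ E ↔ r ∈ E)) :
    orbitHeight E (q * Q) =
      q * orbitHeight E Q + ∑ j ∈ Finset.Ico 1 q, (E.boolIndicator (j * Q)).toNat := by
  induction q, hq using Nat.le_induction with
  | base => simp
  | succ q hq ih =>
    rw [Nat.succ_mul, orbitHeight_add (hE q q.lt_succ_self) hQ,
      visitTime_eq_orbitHeight_add (Nat.mul_pos hq hQ), ih fun i hi => hE i (Nat.lt_succ_of_lt hi),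
      Finset.sum_Ico_succ_top hq]
    ring

end NatOrbit

section RankOne

variable (p : ℕ) [Fact p.Prime] (M : ℕ → ℕ) (A : ℕ → ℕ → Bool)

/-- The base of the spacers: at stage `n`, a spacer is put below the residue class of `i * p ^ M n`
modulo `p ^ M (n + 1)`, where `0 < i < p ^ (M (n + 1) - M n)`, when `A n i` holds. -/
def spacerSet : Set ℤ_[p] :=
  {y | ∃ n i, A n i = true ∧ 0 < i ∧ i < p ^ (M (n + 1) - M n) ∧
    PadicInt.toZModPow (M (n + 1)) y = (i * p ^ M n : ℕ)}

/-- The natural numbers lying in `spacerSet p M A`. -/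
def spacerIndices : Set ℕ := Nat.cast ⁻¹' spacerSet p M A

/-- The residue modulo `p ^ m` of the first coordinate, together with the second coordinate. -/
def residueCode (m : ℕ) (x : ℤ_[p] × Bool) : ZMod (p ^ m) × Bool :=
  (PadicInt.toZModPow m x.1, x.2)

lemma measurableSet_spacerSet : MeasurableSet (spacerSet p M A) := by
  have : spacerSet p M A = ⋃ (n : ℕ) (i : ℕ) (_ : A n i = true) (_ : 0 < i)
      (_ : i < p ^ (M (n + 1) - M n)),
      PadicInt.toZModPow (M (n + 1)) ⁻¹' {((i * p ^ M n : ℕ) : ZMod (p ^ M (n + 1)))} := by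
    ext y
    simp only [spacerSet, Set.mem_ofPred_eq, Set.mem_iUnion, Set.mem_preimage,
      Set.mem_singleton_iff, exists_prop]
  rw [this]
  exact MeasurableSet.iUnion fun n => .iUnion fun i => .iUnion fun _ => .iUnion fun _ =>
    .iUnion fun _ => measurableSet_preimage_toZModPow _ _

/-- The odometer `y ↦ y + 1` of `ℤ_[p]` with a spacer put below each point of `spacerSet p M A`. -/
def spacedOdometer : ℤ_[p] × Bool ≃ᵐ ℤ_[p] × Bool :=
  skyscraper (MeasurableEquiv.addRight 1) (measurableSet_spacerSet p M A)

/-- The invariant probability measure of `spacedOdometer p M A`. -/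
def spacedMeasure : Measure (ℤ_[p] × Bool) := skyscraperMeasure (padicHaar p) (spacerSet p M A)

instance : IsProbabilityMeasure (spacedMeasure p M A) := by
  unfold spacedMeasure; infer_instance

/-- The height of the `n`-th tower of `spacedOdometer p M A`. -/
def spacedHeight (n : ℕ) : ℕ := orbitHeight (spacerIndices p M A) (p ^ M n)

lemma measurePreserving_spacedOdometer :
    MeasurePreserving (spacedOdometer p M A) (spacedMeasure p M A) (spacedMeasure p M A) :=
  measurePreserving_skyscraper (measurePreserving_add_right (padicHaar p) 1) _

variable {p}

lemma measurableSet_preimage_residueCode {m : ℕ} (R : Set (ZMod (p ^ m) × Bool)) :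
    MeasurableSet (residueCode p m ⁻¹' R) := by
  have : residueCode p m ⁻¹' R =
      ⋃ b, (PadicInt.toZModPow m ⁻¹' {r | (r, b) ∈ R}) ×ˢ {b} := by
    ext ⟨y, b⟩
    simp [residueCode]
  rw [this]
  exact .iUnion fun b => (measurableSet_preimage_toZModPow m _).prod (measurableSet_singleton b)

lemma image_preimage_residueCode {f : ℤ_[p] × Bool → ℤ_[p] × Bool} {m : ℕ} {r : ZMod (p ^ m)}
    {b b' : Bool} (a : ℕ) (hf : ∀ y, PadicInt.toZModPow m y = r → f (y, b) = (y + a, b')) :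
    f '' (residueCode p m ⁻¹' {(r, b)}) = residueCode p m ⁻¹' {(r + a, b')} := by
  ext ⟨z, c⟩
  simp only [residueCode, Set.mem_image, Set.mem_preimage, Set.mem_singleton_iff, Prod.mk.injEq]
  constructor
  · rintro ⟨⟨y, d⟩, ⟨hy, rfl⟩, h⟩
    rw [hf y hy, Prod.mk.injEq] at h
    rw [← h.1, map_add, hy, map_natCast]
    exact ⟨rfl, h.2.symm⟩
  · rintro ⟨hz, rfl⟩
    have hy : PadicInt.toZModPow m (z - (a : ℤ_[p])) = r := by
      rw [map_sub, hz, map_natCast, add_sub_cancel_right]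
    exact ⟨(z - a, b), ⟨hy, rfl⟩, by rw [hf _ hy, sub_add_cancel]⟩

lemma toZModPow_eq_natCast_of_le {m n : ℕ} (h : m ≤ n) {y : ℤ_[p]} {a : ℕ}
    (hy : PadicInt.toZModPow n y = a) : PadicInt.toZModPow m y = a := by
  rw [← PadicInt.cast_toZModPow m n h, hy, ZMod.cast_natCast (pow_dvd_pow p h)]

lemma toZModPow_eq_zero_of_le {m n : ℕ} (h : m ≤ n) {y : ℤ_[p]} {N i : ℕ} (hN : n ≤ N)
    (hy : PadicInt.toZModPow N y = (i * p ^ n : ℕ)) : PadicInt.toZModPow m y = 0 := by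
  rw [toZModPow_eq_natCast_of_le (h.trans hN) hy, ZMod.natCast_eq_zero_iff]
  exact (pow_dvd_pow p h).mul_left i

variable {M A}

lemma mem_spacerSet_congr (hM : StrictMono M) {n : ℕ} {y z : ℤ_[p]}
    (h : PadicInt.toZModPow (M n) y = PadicInt.toZModPow (M n) z)
    (h0 : PadicInt.toZModPow (M n) y ≠ 0) :
    y ∈ spacerSet p M A ↔ z ∈ spacerSet p M A := by
  suffices imp : ∀ y z : ℤ_[p], PadicInt.toZModPow (M n) y = PadicInt.toZModPow (M n) z →
      PadicInt.toZModPow (M n) y ≠ 0 → y ∈ spacerSet p M A → z ∈ spacerSet p M A from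
    ⟨imp y z h h0, imp z y h.symm (h ▸ h0)⟩
  rintro y z h h0 ⟨k, i, hA, hi, hiq, hy⟩
  rcases lt_or_ge k n with hk | hk
  · refine ⟨k, i, hA, hi, hiq, ?_⟩
    rw [← PadicInt.cast_toZModPow _ _ (hM.monotone hk), ← h, PadicInt.cast_toZModPow _ _
      (hM.monotone hk), hy]
  · exact absurd (toZModPow_eq_zero_of_le (hM.monotone hk) (hM.monotone k.le_succ) hy) h0

lemma pow_sub_mul_pow_stage (p : ℕ) (hM : StrictMono M) (n : ℕ) :
    p ^ (M (n + 1) - M n) * p ^ M n = p ^ M (n + 1) :=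
  pow_sub_mul_pow p (hM.monotone n.le_succ)

lemma mul_pow_lt_pow_stage (hM : StrictMono M) {n i : ℕ} (hi : i < p ^ (M (n + 1) - M n)) :
    i * p ^ M n < p ^ M (n + 1) := by
  rw [← pow_sub_mul_pow_stage p hM n]
  exact Nat.mul_lt_mul_of_pos_right hi (pow_pos (Fact.out : p.Prime).pos _)

lemma natCast_injOn_zmod {N a b : ℕ} (ha : a < N) (hb : b < N) (h : (a : ZMod N) = b) : a = b := by
  rwa [ZMod.natCast_eq_natCast_iff', Nat.mod_eq_of_lt ha, Nat.mod_eq_of_lt hb] at h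

lemma stage_le_of_toZModPow_eq (hM : StrictMono M) {k n i j : ℕ} {y : ℤ_[p]} (hj : 0 < j)
    (hjq : j < p ^ (M (k + 1) - M k))
    (hk : PadicInt.toZModPow (M (k + 1)) y = (j * p ^ M k : ℕ))
    (hn : PadicInt.toZModPow (M (n + 1)) y = (i * p ^ M n : ℕ)) : n ≤ k := by
  by_contra! hkn
  have h0 : ((j * p ^ M k : ℕ) : ZMod (p ^ M (k + 1))) = (0 : ℕ) := by
    rw [← hk, Nat.cast_zero]
    exact toZModPow_eq_zero_of_le (hM.monotone hkn) (hM.monotone n.le_succ) hn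
  have hp := (Fact.out : p.Prime).pos
  exact (Nat.mul_pos hj (pow_pos hp _)).ne'
    (natCast_injOn_zmod (mul_pow_lt_pow_stage hM hjq) (pow_pos hp _) h0)

lemma mem_spacerSet_iff (hM : StrictMono M) {n i : ℕ} {y : ℤ_[p]} (hi : 0 < i)
    (hiq : i < p ^ (M (n + 1) - M n))
    (h : PadicInt.toZModPow (M (n + 1)) y = (i * p ^ M n : ℕ)) :
    y ∈ spacerSet p M A ↔ A n i = true := by
  refine ⟨?_, fun hA => ⟨n, i, hA, hi, hiq, h⟩⟩
  rintro ⟨k, j, hA, hj, hjq, hk⟩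
  obtain rfl : k = n :=
    le_antisymm (stage_le_of_toZModPow_eq hM hi hiq h hk) (stage_le_of_toZModPow_eq hM hj hjq hk h)
  have := natCast_injOn_zmod (mul_pow_lt_pow_stage hM hiq) (mul_pow_lt_pow_stage hM hjq)
    (h.symm.trans hk)
  rwa [Nat.eq_of_mul_eq_mul_right (pow_pos (Fact.out : p.Prime).pos _) this]

lemma add_natCast_mem_spacerSet_iff (hM : StrictMono M) {n r : ℕ} {y : ℤ_[p]}
    (hy : PadicInt.toZModPow (M n) y = 0) (hr : 0 < r) (hrQ : r < p ^ M n) :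
    y + r ∈ spacerSet p M A ↔ r ∈ spacerIndices p M A := by
  refine mem_spacerSet_congr (z := (r : ℤ_[p])) hM (n := n) (by rw [map_add, hy, zero_add]) ?_
  rw [map_add, hy, zero_add, map_natCast, ← Nat.cast_zero]
  exact fun h0 => hr.ne' (natCast_injOn_zmod hrQ (hr.trans hrQ) h0)

lemma mul_pow_add_mem_spacerIndices_iff (hM : StrictMono M) (n i : ℕ) {r : ℕ} (hr : 0 < r)
    (hrQ : r < p ^ M n) : i * p ^ M n + r ∈ spacerIndices p M A ↔ r ∈ spacerIndices p M A := by
  rw [← add_natCast_mem_spacerSet_iff hM (y := (i * p ^ M n : ℕ)) (n := n) ?_ hr hrQ, spacerIndices,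
    Set.mem_preimage, Nat.cast_add]
  rw [map_natCast, ZMod.natCast_eq_zero_iff]
  exact dvd_mul_left _ _

lemma boolIndicator_spacerIndices_mul_pow (hM : StrictMono M) {n i : ℕ} (hi : 0 < i)
    (hiq : i < p ^ (M (n + 1) - M n)) :
    (spacerIndices p M A).boolIndicator (i * p ^ M n) = A n i := by
  rw [← Bool.coe_iff_coe, ← Set.mem_iff_boolIndicator]
  exact mem_spacerSet_iff hM hi hiq (map_natCast _ _)

lemma spacedHeight_succ (hM : StrictMono M) (n : ℕ) :
    spacedHeight p M A (n + 1) = p ^ (M (n + 1) - M n) * spacedHeight p M A n +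
      ∑ i ∈ Finset.Ico 1 (p ^ (M (n + 1) - M n)), (A n i).toNat := by
  have hp := (Fact.out : p.Prime).pos
  rw [spacedHeight, ← pow_sub_mul_pow_stage p hM n, orbitHeight_mul (pow_pos hp _) (pow_pos hp _)
    fun i _ r hr hrQ => mul_pow_add_mem_spacerIndices_iff hM n i hr hrQ]
  congr 1
  refine Finset.sum_congr rfl fun i hi => ?_
  rw [boolIndicator_spacerIndices_mul_pow hM (Finset.mem_Ico.1 hi).1 (Finset.mem_Ico.1 hi).2]

lemma spacedHeight_eq_towerHeight (hM : StrictMono M) (hM0 : M 0 = 0) (n : ℕ) :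
    spacedHeight p M A n =
      towerHeight (fun n => p ^ (M (n + 1) - M n)) (fun n i => (A n i).toNat) n := by
  induction n with
  | zero => simp [spacedHeight, hM0, orbitHeight, visitTime, towerHeight]
  | succ n ih => rw [spacedHeight_succ hM, ih]; rfl

lemma iterate_spacedOdometer (hM : StrictMono M) {n t : ℕ} {y : ℤ_[p]}
    (hy : PadicInt.toZModPow (M n) y = 0) (ht : t < spacedHeight p M A n) :
    (spacedOdometer p M A)^[t] (y, false) =
      (y + (orbit (spacerIndices p M A) t).1, (orbit (spacerIndices p M A) t).2) := by
  have iterate_add (r : ℕ) : (MeasurableEquiv.addRight (1 : ℤ_[p]))^[r] y = y + r := by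
    simp [MeasurableEquiv.coe_addRight]
  rw [spacedOdometer, coe_skyscraper, iterate_skyscraperStep (fun r hr hrQ => ?_)
    (pow_pos (Fact.out : p.Prime).pos _) ht, iterate_add]
  rw [iterate_add]
  exact add_natCast_mem_spacerSet_iff hM hy hr hrQ

lemma iterate_spacedHeight (hM : StrictMono M) {n : ℕ} {y : ℤ_[p]}
    (hy : PadicInt.toZModPow (M n) y = 0) :
    (spacedOdometer p M A)^[spacedHeight p M A n] (y, false) =
      (y + (p ^ M n : ℕ), (spacerSet p M A).boolIndicator (y + (p ^ M n : ℕ))) := by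
  have last : y + ((p ^ M n - 1 : ℕ) : ℤ_[p]) + 1 = y + (p ^ M n : ℕ) := by
    rw [add_assoc, ← Nat.cast_add_one, Nat.sub_add_cancel (pow_pos (Fact.out : p.Prime).pos _)]
  rw [spacedHeight, orbitHeight, Function.iterate_succ_apply',
    iterate_spacedOdometer hM hy (Nat.lt_succ_self _), orbit_visitTime, spacedOdometer,
    coe_skyscraper, skyscraperStep_false, MeasurableEquiv.coe_addRight]
  exact last ▸ rfl

variable (p M A)

/-- The residue code of the `k`-th level of a tower of `spacedOdometer p M A`. -/
def levelCode (m k : ℕ) : ZMod (p ^ m) × Bool :=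
  ((orbit (spacerIndices p M A) k).1, (orbit (spacerIndices p M A) k).2)

variable {p M A}

lemma image_base (hM : StrictMono M) {n k : ℕ} (hk : k < spacedHeight p M A n) :
    (spacedOdometer p M A)^[k] '' (residueCode p (M n) ⁻¹' {(0, false)}) =
      residueCode p (M n) ⁻¹' {levelCode p M A (M n) k} := by
  rw [image_preimage_residueCode _ fun y hy => iterate_spacedOdometer hM hy hk, zero_add, levelCode]

lemma disjoint_levels_spacedOdometer (hM : StrictMono M) {n k l : ℕ}
    (hk : k < spacedHeight p M A n) (hl : l < spacedHeight p M A n) (hkl : k ≠ l) :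
    Disjoint ((spacedOdometer p M A)^[k] '' (residueCode p (M n) ⁻¹' {(0, false)}))
      ((spacedOdometer p M A)^[l] '' (residueCode p (M n) ⁻¹' {(0, false)})) := by
  have hQ := pow_pos (Fact.out : p.Prime).pos (M n)
  rw [image_base hM hk, image_base hM hl]
  refine Disjoint.preimage _ (Set.disjoint_singleton.2 fun h =>
    hkl (injective_orbit (spacerIndices p M A) ?_))
  rw [levelCode, levelCode, Prod.mk.injEq] at h
  exact Prod.ext (natCast_injOn_zmod (orbit_fst_lt hQ hk) (orbit_fst_lt hQ hl) h.1) h.2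

/-- The `i`-th slice of the base of the `n`-th tower, `1 ≤ i ≤ p ^ (M (n + 1) - M n)`. -/
def slice (p : ℕ) [Fact p.Prime] (M : ℕ → ℕ) (n i : ℕ) : Set (ℤ_[p] × Bool) :=
  residueCode p (M (n + 1)) ⁻¹' {((((i - 1) * p ^ M n : ℕ) : ZMod _), false)}

/-- The spacer put above `slice p M n i`. -/
def spacer (p : ℕ) [Fact p.Prime] (M : ℕ → ℕ) (n i : ℕ) : Set (ℤ_[p] × Bool) :=
  residueCode p (M (n + 1)) ⁻¹' {(((i * p ^ M n : ℕ) : ZMod _), true)}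

lemma biUnion_slice (hM : StrictMono M) (n : ℕ) :
    ⋃ i ∈ Finset.Icc 1 (p ^ (M (n + 1) - M n)), slice p M n i =
      residueCode p (M n) ⁻¹' {(0, false)} := by
  have hle := hM.monotone n.le_succ
  have hp := (Fact.out : p.Prime).pos
  ext ⟨y, b⟩
  simp only [Set.mem_iUnion, Finset.mem_Icc, slice, residueCode, Set.mem_preimage,
    Set.mem_singleton_iff, Prod.mk.injEq, exists_prop]
  constructor
  · rintro ⟨i, -, hy, rfl⟩
    exact ⟨toZModPow_eq_zero_of_le le_rfl hle hy, rfl⟩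
  · rintro ⟨hy, rfl⟩
    have : NeZero (p ^ M (n + 1)) := ⟨(pow_pos hp _).ne'⟩
    set r := PadicInt.toZModPow (M (n + 1)) y
    obtain ⟨c, hc⟩ : p ^ M n ∣ r.val := by
      rw [← ZMod.natCast_eq_zero_iff, ← hy]
      exact (toZModPow_eq_natCast_of_le hle (ZMod.natCast_zmod_val r).symm).symm
    have hcq : p ^ M n * c < p ^ M n * p ^ (M (n + 1) - M n) := by
      rw [← hc, mul_comm, pow_sub_mul_pow_stage p hM]
      exact ZMod.val_lt r
    refine ⟨c + 1, ⟨by omega, Nat.lt_of_mul_lt_mul_left hcq⟩, ?_, rfl⟩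
    rw [Nat.add_sub_cancel, mul_comm, ← hc, ZMod.natCast_zmod_val]

lemma disjoint_slice (hM : StrictMono M) {n i j : ℕ} (hi : 1 ≤ i)
    (hiq : i ≤ p ^ (M (n + 1) - M n)) (hj : 1 ≤ j) (hjq : j ≤ p ^ (M (n + 1) - M n))
    (hij : i ≠ j) : Disjoint (slice p M n i) (slice p M n j) := by
  refine Disjoint.preimage _ (Set.disjoint_singleton.2 fun h => hij ?_)
  have mul_pow_eq := natCast_injOn_zmod (mul_pow_lt_pow_stage hM (by omega))
    (mul_pow_lt_pow_stage hM (by omega)) (Prod.ext_iff.1 h).1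
  have pred_eq := Nat.eq_of_mul_eq_mul_right (pow_pos (Fact.out : p.Prime).pos _) mul_pow_eq
  omega

lemma image_slice (hM : StrictMono M) {n i : ℕ} (hi : 1 ≤ i) (hiq : i < p ^ (M (n + 1) - M n)) :
    (spacedOdometer p M A)^[spacedHeight p M A n] '' slice p M n i =
      if A n i = true then spacer p M n i else slice p M n (i + 1) := by
  have next : (i - 1) * p ^ M n + p ^ M n = i * p ^ M n := by
    rw [← Nat.succ_mul, Nat.succ_eq_add_one, Nat.sub_add_cancel hi]
  have image_eq : (spacedOdometer p M A)^[spacedHeight p M A n] '' slice p M n i =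
      residueCode p (M (n + 1)) ⁻¹' {(((i * p ^ M n : ℕ) : ZMod _), A n i)} := by
    rw [slice, image_preimage_residueCode (p ^ M n) fun y hy => ?_, ← Nat.cast_add, next]
    rw [iterate_spacedHeight hM (toZModPow_eq_zero_of_le le_rfl (hM.monotone n.le_succ) hy)]
    congr 1
    rw [← Bool.coe_iff_coe, ← Set.mem_iff_boolIndicator]
    exact mem_spacerSet_iff hM hi hiq (by rw [map_add, hy, map_natCast, ← Nat.cast_add, next])
  rw [image_eq]
  cases A n i <;> rfl

lemma image_spacer (hM : StrictMono M) {n i : ℕ} (hi : 1 ≤ i) (hiq : i < p ^ (M (n + 1) - M n))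
    (hA : A n i = true) : spacedOdometer p M A '' spacer p M n i = slice p M n (i + 1) := by
  rw [spacer, slice, image_preimage_residueCode 0 fun y hy => ?_, Nat.add_sub_cancel, Nat.cast_zero,
    add_zero]
  have : (spacerSet p M A).boolIndicator y = true :=
    (Set.mem_iff_boolIndicator _ _).1 ((mem_spacerSet_iff hM hi hiq hy).2 hA)
  rw [spacedOdometer, coe_skyscraper, skyscraperStep_true, this, Nat.cast_zero, add_zero,
    Bool.not_true]

lemma exists_levelCode_eq (hM : StrictMono M) {n : ℕ} {x : ℤ_[p] × Bool}
    (hx : x ∈ skyscraperDomain (spacerSet p M A))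
    (hx0 : x.2 = true → PadicInt.toZModPow (M n) x.1 ≠ 0) :
    ∃ k < spacedHeight p M A n, levelCode p M A (M n) k = residueCode p (M n) x := by
  have : NeZero (p ^ M n) := ⟨(pow_pos (Fact.out : p.Prime).pos _).ne'⟩
  obtain ⟨y, b⟩ := x
  obtain ⟨r, hrQ, hr⟩ : ∃ r < p ^ M n, PadicInt.toZModPow (M n) y = r :=
    ⟨_, ZMod.val_lt _, (ZMod.natCast_zmod_val _).symm⟩
  have visit_lt : visitTime (spacerIndices p M A) r < spacedHeight p M A n :=
    Nat.lt_succ_of_le ((strictMono_visitTime _).monotone (Nat.le_sub_one_of_lt hrQ))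
  cases b with
  | false => exact ⟨_, visit_lt, by rw [levelCode, orbit_visitTime, residueCode, hr]⟩
  | true =>
    obtain ⟨s, rfl⟩ := Nat.exists_eq_succ_of_ne_zero (n := r) fun h0 =>
      hx0 rfl (by rw [hr, h0, Nat.cast_zero])
    have spacer_below : (spacerIndices p M A).boolIndicator (s + 1) = true :=
      (Set.mem_iff_boolIndicator _ _).1
        ((mem_spacerSet_congr (z := ((s + 1 : ℕ) : ℤ_[p])) hM (n := n) (by rw [hr, map_natCast])
          (hx0 rfl)).1 (hx rfl))
    refine ⟨visitTime (spacerIndices p M A) s + 1, lt_of_le_of_lt ?_ visit_lt, ?_⟩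
    · exact (strictMono_visitTime _) s.lt_succ_self
    · rw [levelCode, orbit_succ, orbit_visitTime, skyscraperStep_false, residueCode, hr,
        Nat.succ_eq_add_one, spacer_below]

end RankOne

section CutAndStack

variable {p : ℕ} [Fact p.Prime] {M : ℕ → ℕ} {A : ℕ → ℕ → Bool}

lemma mem_biUnion_image_base_iff (hM : StrictMono M) {n : ℕ} (R : Set (ZMod (p ^ M n) × Bool))
    {s : Finset ℕ} (hs : ∀ k, k ∈ s ↔ k < spacedHeight p M A n ∧ levelCode p M A (M n) k ∈ R)
    {x : ℤ_[p] × Bool} (hx : x ∈ skyscraperDomain (spacerSet p M A))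
    (hx0 : x.2 = true → PadicInt.toZModPow (M n) x.1 ≠ 0) :
    x ∈ ⋃ k ∈ s, (spacedOdometer p M A)^[k] '' (residueCode p (M n) ⁻¹' {(0, false)}) ↔
      residueCode p (M n) x ∈ R := by
  have levels : ⋃ k ∈ s, (spacedOdometer p M A)^[k] '' (residueCode p (M n) ⁻¹' {(0, false)}) =
      ⋃ k ∈ s, residueCode p (M n) ⁻¹' {levelCode p M A (M n) k} :=
    Set.iUnion₂_congr fun k hk => image_base hM ((hs k).1 hk).1
  simp only [levels, Set.mem_iUnion, Set.mem_preimage, Set.mem_singleton_iff, exists_prop]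
  constructor
  · rintro ⟨k, hk, h⟩
    exact h ▸ ((hs k).1 hk).2
  · intro hR
    obtain ⟨k, hk, h⟩ := exists_levelCode_eq hM hx hx0
    exact ⟨k, (hs k).2 ⟨hk, h ▸ hR⟩, h.symm⟩

lemma spacedMeasure_real_le {B : Set (ℤ_[p] × Bool)} (hB : MeasurableSet B) :
    (spacedMeasure p M A).real B ≤ (padicHaar p).real {y | (y, false) ∈ B} +
      (padicHaar p).real ({y | (y, true) ∈ B} ∩ spacerSet p M A) := by
  rw [spacedMeasure, skyscraperMeasure_real_apply (measurableSet_spacerSet p M A) hB]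
  exact mul_le_of_le_one_left (by positivity)
    (inv_le_one_of_one_le₀ (le_add_of_nonneg_right measureReal_nonneg))

lemma spacedMeasure_real_symmDiff_biUnion_image_base_le (hM : StrictMono M) {n : ℕ}
    (R : Bool → Set (ZMod (p ^ M n))) {s : Finset ℕ}
    (hs : ∀ k, k ∈ s ↔ k < spacedHeight p M A n ∧
      (levelCode p M A (M n) k).1 ∈ R (levelCode p M A (M n) k).2)
    {B : Set (ℤ_[p] × Bool)} (hB : MeasurableSet B) :
    (spacedMeasure p M A).real (symmDiff B
        (⋃ k ∈ s, (spacedOdometer p M A)^[k] '' (residueCode p (M n) ⁻¹' {(0, false)}))) ≤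
      (padicHaar p).real
          (symmDiff (PadicInt.toZModPow (M n) ⁻¹' R false) {y | (y, false) ∈ B}) +
        ((padicHaar p).real
          (symmDiff (PadicInt.toZModPow (M n) ⁻¹' R true) {y | (y, true) ∈ B}) +
        ((p : ℝ) ^ M n)⁻¹) := by
  have mem_union_iff {y : ℤ_[p]} {b : Bool} (hx : b = true → y ∈ spacerSet p M A)
      (hx0 : b = true → PadicInt.toZModPow (M n) y ≠ 0) :=
    mem_biUnion_image_base_iff hM {c | c.1 ∈ R c.2} hs (x := (y, b)) hx hx0
  set U := ⋃ k ∈ s, (spacedOdometer p M A)^[k] '' (residueCode p (M n) ⁻¹' {(0, false)})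
  have measurable_U : MeasurableSet U := by
    refine Finset.measurableSet_biUnion _ fun k hk => ?_
    rw [image_base hM ((hs k).1 hk).1]
    exact measurableSet_preimage_residueCode _
  refine (spacedMeasure_real_le (hB.symmDiff measurable_U)).trans (add_le_add ?_ ?_)
  · refine measureReal_mono fun y hy => ?_
    simp only [Set.mem_ofPred_eq, Set.mem_symmDiff, Set.mem_preimage,
      mem_union_iff (y := y) (b := false) (by simp) (by simp)] at hy ⊢
    exact hy.symm
  · rw [← padicHaar_real_preimage_toZModPow_singleton (M n) 0]
    refine (measureReal_mono ?_).trans (measureReal_union_le _ _)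
    rintro y ⟨hy, hyE⟩
    refine or_iff_not_imp_right.2 fun hy0 => ?_
    simp only [Set.mem_ofPred_eq, Set.mem_symmDiff, Set.mem_preimage,
      mem_union_iff (y := y) (b := true) (fun _ => hyE) (fun _ => hy0)] at hy ⊢
    exact hy.symm

lemma eventually_exists_symmDiff_biUnion_image_base_lt (hM : StrictMono M)
    {B : Set (ℤ_[p] × Bool)} (hB : MeasurableSet B) {ε : ℝ} (hε : 0 < ε) :
    ∀ᶠ n in atTop, ∃ s : Finset ℕ, s ⊆ Finset.range (spacedHeight p M A n) ∧
      (spacedMeasure p M A).real (symmDiff B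
        (⋃ k ∈ s, (spacedOdometer p M A)^[k] '' (residueCode p (M n) ⁻¹' {(0, false)}))) < ε := by
  classical
  have approx (b : Bool) : ∀ᶠ n in atTop, ∃ R : Set (ZMod (p ^ M n)),
      (padicHaar p).real (symmDiff (PadicInt.toZModPow (M n) ⁻¹' R) {y | (y, b) ∈ B}) < ε / 3 := by
    obtain ⟨m₀, h⟩ := exists_forall_ge_symmDiff_preimage_toZModPow_lt (padicHaar p)
      (measurable_prodMk_right (y := b) hB) (by positivity : 0 < ε / 3)
    exact hM.tendsto_atTop.eventually (eventually_atTop.2 ⟨m₀, h⟩)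
  have small : ∀ᶠ n in atTop, ((p : ℝ) ^ M n)⁻¹ < ε / 3 := by
    have hp : 1 < (p : ℝ) := mod_cast (Fact.out : p.Prime).one_lt
    have : Tendsto (fun m : ℕ => ((p : ℝ) ^ m)⁻¹) atTop (𝓝 0) :=
      tendsto_inv_atTop_zero.comp (tendsto_pow_atTop_atTop_of_one_lt hp)
    exact (this.comp hM.tendsto_atTop).eventually_lt_const (by positivity)
  filter_upwards [approx false, approx true, small] with n ⟨R₀, hR₀⟩ ⟨R₁, hR₁⟩ hn
  refine ⟨(Finset.range (spacedHeight p M A n)).filter fun k =>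
    (levelCode p M A (M n) k).1 ∈ bif (levelCode p M A (M n) k).2 then R₁ else R₀,
    Finset.filter_subset _ _, ?_⟩
  refine (spacedMeasure_real_symmDiff_biUnion_image_base_le hM (fun b => bif b then R₁ else R₀)
    (by simp only [Finset.mem_filter, Finset.mem_range, implies_true]) hB).trans_lt ?_
  simp only [cond_false, cond_true]
  linarith

lemma summable_spacerCount_div_towerHeight (hM : StrictMono M) (hM0 : M 0 = 0) :
    Summable fun n : ℕ =>
      (spacerCount (fun n => p ^ (M (n + 1) - M n)) (fun n i => (A n i).toNat) n : ℝ) /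
        towerHeight (fun n => p ^ (M (n + 1) - M n)) (fun n i => (A n i).toNat) (n + 1) := by
  have hp : 1 < (p : ℝ) := mod_cast (Fact.out : p.Prime).one_lt
  have hp0 := (Fact.out : p.Prime).pos
  refine Summable.of_nonneg_of_le (fun n => by positivity) (fun n => ?_)
    (summable_geometric_of_lt_one (by positivity) (inv_lt_one_of_one_lt₀ hp))
  have count_le : spacerCount (fun n => p ^ (M (n + 1) - M n)) (fun n i => (A n i).toNat) n ≤
      p ^ (M (n + 1) - M n) := by
    refine (Finset.sum_le_card_nsmul _ _ 1 fun i _ => Bool.toNat_le _).trans ?_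
    rw [smul_eq_mul, mul_one, Nat.card_Ico]
    exact Nat.sub_le _ _
  have le_height : p ^ M (n + 1) ≤ spacedHeight p M A (n + 1) := le_orbitHeight _ _
  have height_pos := (pow_pos hp0 (M (n + 1))).trans_le le_height
  have pow_le : p ^ n ≤ p ^ M n := Nat.pow_le_pow_right hp0 hM.le_apply
  rw [← spacedHeight_eq_towerHeight hM hM0, inv_pow, ← one_div,
    div_le_div_iff₀ (mod_cast height_pos) (by positivity), one_mul]
  rw [← pow_sub_mul_pow_stage p hM n] at le_height
  exact mod_cast (Nat.mul_le_mul count_le pow_le).trans le_height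

lemma isCutAndStack_spacedOdometer (hM : StrictMono M) (hM0 : M 0 = 0) :
    IsCutAndStack (spacedMeasure p M A) (spacedOdometer p M A) (fun n => p ^ (M (n + 1) - M n))
      (fun n i => (A n i).toNat) (fun n => residueCode p (M n) ⁻¹' {(0, false)}) (slice p M)
      (fun n i _ => spacer p M n i) where
  two_le_q n := (Fact.out : p.Prime).two_le.trans
    (Nat.le_self_pow (Nat.sub_ne_zero_of_lt (hM n.lt_succ_self)) p)
  summable_spacers := summable_spacerCount_div_towerHeight hM hM0
  measurable_base _ := measurableSet_preimage_residueCode _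
  measurable_slice _ _ _ _ := measurableSet_preimage_residueCode _
  measurable_spacer _ _ _ _ _ _ _ := measurableSet_preimage_residueCode _
  disjoint_levels n k l hk hl := by
    rw [← spacedHeight_eq_towerHeight hM hM0] at hk hl
    exact disjoint_levels_spacedOdometer hM hk hl
  slices_cover := biUnion_slice hM
  slices_disjoint _ _ _ hi hiq hj hjq := disjoint_slice hM hi hiq hj hjq
  glue_slice n i hi hiq := by
    rw [← spacedHeight_eq_towerHeight hM hM0, image_slice hM hi hiq]
    cases A n i <;> rfl
  glue_spacer n i j hi hiq hj hji := by
    obtain rfl : j = 1 := le_antisymm (hji.trans (Bool.toNat_le _)) hj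
    obtain hA : A n i = true := Bool.toNat_eq_one.1 (le_antisymm (Bool.toNat_le _) hji)
    rw [image_spacer hM hi hiq hA, hA, Bool.toNat_true, if_neg (lt_irrefl 1)]
  base_succ n := by simp [slice]
  generating B hB ε hε := by
    simpa only [spacedHeight_eq_towerHeight hM hM0] using
      eventually_exists_symmDiff_biUnion_image_base_lt hM hB hε

lemma isRankOneSystem_spacedOdometer (hM : StrictMono M) (hM0 : M 0 = 0) :
    IsRankOneSystem (spacedMeasure p M A) (spacedOdometer p M A) (spacedHeight p M A) :=
  ⟨inferInstance, measurePreserving_spacedOdometer p M A, _, _, _, _, _,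
    isCutAndStack_spacedOdometer hM hM0, funext (spacedHeight_eq_towerHeight hM hM0)⟩

end CutAndStack

section Entropy

lemma sum_mul_map_le_of_concaveOn {ι : Type*} [Fintype ι] {f : ℝ → ℝ}
    (hf : ConcaveOn ℝ (Set.Icc 0 1) f) (hf0 : ∀ x ∈ Set.Icc (0 : ℝ) 1, 0 ≤ f x) {p c : ι → ℝ}
    (hp : ∀ i, 0 ≤ p i) (hc : ∀ i, c i ∈ Set.Icc (0 : ℝ) 1) {x : ℝ} (hx : ∑ i, p i * c i ≤ x)
    (hx' : x ≤ ∑ i, p i * c i + (1 - ∑ i, p i)) : ∑ i, p i * f (c i) ≤ f x := by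
  set p₀ := 1 - ∑ i, p i with hp₀
  set x₀ := x - ∑ i, p i * c i with hx₀
  have x₀_nonneg : 0 ≤ x₀ := sub_nonneg.2 hx
  have x₀_le : x₀ ≤ p₀ := by linarith
  have p₀_nonneg : 0 ≤ p₀ := x₀_nonneg.trans x₀_le
  have mul_div : p₀ * (x₀ / p₀) = x₀ :=
    mul_div_cancel_of_imp' fun h => le_antisymm (h ▸ x₀_le) x₀_nonneg
  -- The missing mass `p₀` is placed at `x₀ / p₀`, which is `0` when `p₀ = 0`.
  have quotient_mem : x₀ / p₀ ∈ Set.Icc (0 : ℝ) 1 :=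
    ⟨div_nonneg x₀_nonneg p₀_nonneg, div_le_one_of_le₀ x₀_le p₀_nonneg⟩
  have jensen := hf.le_map_sum (t := (Finset.univ : Finset (Option ι)))
    (w := fun o => o.elim p₀ p) (p := fun o => o.elim (x₀ / p₀) c)
    (by rintro (_ | i) _; exacts [p₀_nonneg, hp i])
    (by simp [Fintype.sum_option, hp₀])
    (by rintro (_ | i) _; exacts [quotient_mem, hc i])
  simp only [Fintype.sum_option, Option.elim, smul_eq_mul, mul_div] at jensen
  rw [hx₀, sub_add_cancel, ← hx₀] at jensen
  linarith [mul_nonneg p₀_nonneg (hf0 _ quotient_mem)]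

lemma sum_mul_sum_negMulLog_le {J κ : Type*} [Fintype J] [Fintype κ] {p : J → ℝ} {c : J → κ → ℝ}
    {x : κ → ℝ} (hp : ∀ j, 0 ≤ p j) (hc : ∀ j w, 0 ≤ c j w) (hc1 : ∀ j, ∑ w, c j w = 1)
    (hx : ∀ w, ∑ j, p j * c j w ≤ x w) (hx1 : ∑ w, x w = 1) :
    ∑ j, p j * ∑ w, Real.negMulLog (c j w) ≤ ∑ w, Real.negMulLog (x w) := by
  have remainder (w : κ) : x w - ∑ j, p j * c j w ≤ 1 - ∑ j, p j := by
    calc x w - ∑ j, p j * c j w ≤ ∑ w, (x w - ∑ j, p j * c j w) :=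
          Finset.single_le_sum (f := fun w => x w - ∑ j, p j * c j w)
            (fun w _ => sub_nonneg.2 (hx w)) (Finset.mem_univ w)
      _ = 1 - ∑ j, p j := by
          rw [Finset.sum_sub_distrib, hx1, Finset.sum_comm]
          simp only [← Finset.mul_sum, hc1, mul_one]
  have c_le_one (j : J) (w : κ) : c j w ≤ 1 :=
    hc1 j ▸ Finset.single_le_sum (fun w _ => hc j w) (Finset.mem_univ w)
  simp only [Finset.mul_sum]
  rw [Finset.sum_comm]
  refine Finset.sum_le_sum fun w _ => sum_mul_map_le_of_concaveOn
    (Real.concaveOn_negMulLog.subset Set.Icc_subset_Ici_self (convex_Icc 0 1))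
    (fun y hy => Real.negMulLog_nonneg hy.1 hy.2) hp (fun j => ⟨hc j w, c_le_one j w⟩) (hx w) ?_
  linarith [remainder w]

lemma le_sum_negMulLog_of_le_exp_neg {κ : Type*} [Fintype κ] {c : κ → ℝ} {a : ℝ}
    (hc : ∀ w, 0 ≤ c w) (hc1 : ∑ w, c w = 1) (ha : ∀ w, c w ≤ Real.exp (-a)) :
    a ≤ ∑ w, Real.negMulLog (c w) := by
  rw [← one_mul a, ← hc1, Finset.sum_mul]
  refine Finset.sum_le_sum fun w _ => ?_
  rcases (hc w).eq_or_lt with h | h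
  · simp [← h]
  · have log_le : Real.log (c w) ≤ -a := (Real.log_le_iff_le_exp h).2 (ha w)
    rw [Real.negMulLog, neg_mul_comm]
    exact mul_le_mul_of_nonneg_left (le_neg_of_le_neg log_le) h.le

lemma sum_card_fiber_div_card {B κ : Type*} [Fintype B] [Nonempty B] [Fintype κ] [DecidableEq κ]
    (w : B → κ) :
    ∑ k, ((Finset.univ.filter fun b => w b = k).card / Fintype.card B : ℝ) = 1 := by
  rw [← Finset.sum_div, ← Nat.cast_sum, ← Finset.card_eq_sum_card_fiberwise (by simp),
    Finset.card_univ, div_self (Nat.cast_ne_zero.2 Fintype.card_ne_zero)]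

lemma mul_log_two_le_sum_negMulLog_card_div_card {B κ : Type*} [Fintype B] [Nonempty B] [Fintype κ]
    [DecidableEq κ] {w : B → κ} {D : ℕ}
    (hD : ∀ k, (Finset.univ.filter fun b => w b = k).card * 2 ^ D ≤ Fintype.card B) :
    D * Real.log 2 ≤
      ∑ k, Real.negMulLog ((Finset.univ.filter fun b => w b = k).card / Fintype.card B) := by
  have card_pos : (0 : ℝ) < Fintype.card B := mod_cast Fintype.card_pos
  refine le_sum_negMulLog_of_le_exp_neg (fun k => by positivity) (sum_card_fiber_div_card w)
    fun k => ?_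
  rw [Real.exp_neg, Real.exp_nat_mul, Real.exp_log two_pos, ← one_div,
    div_le_div_iff₀ card_pos (by positivity), one_mul]
  exact mod_cast hD k

lemma mul_sum_card_le_measureReal_preimage {X κ J B : Type*} [MeasurableSpace X] [Fintype J]
    [Fintype B] [DecidableEq κ] {μ : Measure X} [IsFiniteMeasure μ] {φ : X → κ} {L : J × B → Set X}
    (hL : ∀ i, MeasurableSet (L i)) (hdisj : Pairwise (Function.onFun Disjoint L)) {m : ℝ}
    (hm : ∀ i, μ.real (L i) = m) {w : J → B → κ} (hw : ∀ j b, ∀ x ∈ L (j, b), φ x = w j b)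
    (k : κ) : m * ∑ j, ((Finset.univ.filter fun b => w j b = k).card : ℝ) ≤ μ.real (φ ⁻¹' {k}) := by
  have card_eq : ∑ j, (Finset.univ.filter fun b => w j b = k).card =
      (Finset.univ.filter fun i : J × B => w i.1 i.2 = k).card := by
    simp only [Finset.card_filter, Fintype.sum_prod_type]
  calc m * ∑ j, ((Finset.univ.filter fun b => w j b = k).card : ℝ)
      = ∑ i ∈ (Finset.univ : Finset (J × B)).filter (fun i => w i.1 i.2 = k), μ.real (L i) := by
        simp only [hm]
        rw [Finset.sum_const, nsmul_eq_mul, ← card_eq, Nat.cast_sum, mul_comm]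
    _ = μ.real (⋃ i ∈ (Finset.univ : Finset (J × B)).filter (fun i => w i.1 i.2 = k), L i) :=
        (measureReal_biUnion_finset (fun _ _ _ _ h => hdisj h) fun i _ => hL i).symm
    _ ≤ μ.real (φ ⁻¹' {k}) := measureReal_mono <| Set.iUnion₂_subset fun i hi x hx =>
        (hw i.1 i.2 x hx).trans (Finset.mem_filter.1 hi).2

lemma mul_log_two_mul_sum_le_partitionEntropy {X κ J B : Type*} [MeasurableSpace X] [Fintype κ]
    [DecidableEq κ] [Fintype J] [Fintype B] [Nonempty B] {μ : Measure X} [IsProbabilityMeasure μ]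
    {φ : X → κ} (hφ : ∀ k, MeasurableSet (φ ⁻¹' {k})) {L : J × B → Set X}
    (hL : ∀ i, MeasurableSet (L i)) (hdisj : Pairwise (Function.onFun Disjoint L)) {m : ℝ}
    (hm0 : 0 ≤ m) (hm : ∀ i, μ.real (L i) = m) {w : J → B → κ}
    (hw : ∀ j b, ∀ x ∈ L (j, b), φ x = w j b) {D : J → ℕ}
    (hD : ∀ j k, (Finset.univ.filter fun b => w j b = k).card * 2 ^ D j ≤ Fintype.card B) :
    m * Fintype.card B * Real.log 2 * ∑ j, (D j : ℝ) ≤ partitionEntropy μ φ := by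
  have card_pos : (0 : ℝ) < Fintype.card B := mod_cast Fintype.card_pos
  have sum_fibers : ∑ k, μ.real (φ ⁻¹' {k}) = 1 := by
    rw [sum_measureReal_preimage_singleton _ fun k _ => hφ k]
    simp
  calc m * Fintype.card B * Real.log 2 * ∑ j, (D j : ℝ)
      = ∑ j, m * Fintype.card B * (D j * Real.log 2) := by
        rw [Finset.mul_sum]
        exact Finset.sum_congr rfl fun j _ => by ring
    _ ≤ ∑ j, m * Fintype.card B * ∑ k, Real.negMulLog
          ((Finset.univ.filter fun b => w j b = k).card / Fintype.card B) :=
        Finset.sum_le_sum fun j _ => mul_le_mul_of_nonneg_left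
          (mul_log_two_le_sum_negMulLog_card_div_card (hD j)) (by positivity)
    _ ≤ partitionEntropy μ φ := by
        refine sum_mul_sum_negMulLog_le (fun _ => by positivity) (fun _ _ => by positivity)
          (fun j => sum_card_fiber_div_card (w j)) (fun k => ?_) sum_fibers
        simp only [mul_assoc, mul_div_cancel₀ _ card_pos.ne', ← Finset.mul_sum]
        exact mul_sum_card_le_measureReal_preimage hL hdisj hm hw k

end Entropy

section SequenceEntropy

variable {X ι : Type*} [MeasurableSpace X] {T : X → X} {t : ℕ → ℕ} {φ : X → ι}

lemma measurableSet_preimage_sequenceCoding (hT : Measurable T)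
    (hφ : ∀ i, MeasurableSet (φ ⁻¹' {i})) {n : ℕ} (w : Fin n → ι) :
    MeasurableSet (sequenceCoding T t φ n ⁻¹' {w}) := by
  have : sequenceCoding T t φ n ⁻¹' {w} =
      ⋂ k : Fin n, T^[t ((k : ℕ) + 1)] ⁻¹' (φ ⁻¹' {w k}) := by
    ext x
    simp [sequenceCoding, funext_iff]
  rw [this]
  exact .iInter fun k => hT.iterate _ (hφ (w k))

variable [Fintype ι] {μ : Measure X}

lemma sequenceEntropyPartition_le_sequenceEntropy (hφ : ∀ i, MeasurableSet (φ ⁻¹' {i})) :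
    sequenceEntropyPartition μ T t φ ≤ sequenceEntropy μ T t := by
  let e := Fintype.equivFin ι
  have measurable_relabelled : Measurable (e ∘ φ) := measurable_to_countable' fun i => by
    rw [Set.preimage_comp, ← e.image_symm_eq_preimage, Set.image_singleton]
    exact hφ _
  have relabel (n : ℕ) : partitionEntropy μ (sequenceCoding T t φ n) =
      partitionEntropy μ (sequenceCoding T t (e ∘ φ) n) := by
    rw [partitionEntropy, partitionEntropy, ← (Equiv.arrowCongr (.refl (Fin n)) e).sum_comp]
    refine Finset.sum_congr rfl fun w _ => ?_
    congr 3
    ext x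
    simp [sequenceCoding, funext_iff]
  refine le_trans (le_of_eq ?_)
    (le_iSup₂_of_le _ (e ∘ φ) (le_iSup_of_le measurable_relabelled le_rfl))
  simp only [sequenceEntropyPartition, relabel]

lemma le_sequenceEntropyPartition_of_frequently {c : ℝ}
    (h : ∃ᶠ n : ℕ in atTop, c * n ≤ partitionEntropy μ (sequenceCoding T t φ n)) :
    (c : EReal) ≤ sequenceEntropyPartition μ T t φ := by
  refine le_limsup_of_frequently_le' ?_
  refine (h.and_eventually (eventually_gt_atTop 0)).mono fun n ⟨hn, hn0⟩ => ?_
  rw [EReal.coe_le_coe_iff, one_div, inv_mul_eq_div, le_div_iff₀ (Nat.cast_pos.2 hn0)]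
  exact hn

end SequenceEntropy

section Counting

lemma card_mul_two_pow_card_le_of_testBit_eq {W : ℕ} {I : Finset ℕ} (hI : I ⊆ Finset.range W)
    {S : Finset (Fin (2 ^ W))}
    (hS : ∀ b ∈ S, ∀ b' ∈ S, ∀ i ∈ I, (b : ℕ).testBit i = (b' : ℕ).testBit i) :
    S.card * 2 ^ I.card ≤ 2 ^ W := by
  have card_le : S.card ≤ ((Finset.range W \ I).powerset).card := by
    refine Finset.card_le_card_of_injOn
      (fun b => (Finset.range W \ I).filter fun i => (b : ℕ).testBit i = true)
      (fun b _ => Finset.mem_coe.2 (Finset.mem_powerset.2 (Finset.filter_subset _ _))) ?_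
    intro b hb b' hb' h
    refine Fin.ext (Nat.eq_of_testBit_eq fun i => ?_)
    by_cases hiI : i ∈ I
    · exact hS b hb b' hb' i hiI
    rcases lt_or_ge i W with hi | hi
    · have := Finset.ext_iff.1 h i
      simp only [Finset.mem_filter, Finset.mem_sdiff, Finset.mem_range, hi, hiI, not_false_iff,
        and_self, true_and] at this
      exact Bool.eq_iff_iff.2 this
    · rw [Nat.testBit_lt_two_pow (b.2.trans_le (Nat.pow_le_pow_right two_pos hi)),
        Nat.testBit_lt_two_pow (b'.2.trans_le (Nat.pow_le_pow_right two_pos hi))]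
  have card_I_le : I.card ≤ W := by simpa only [Finset.card_range] using Finset.card_le_card hI
  rw [Finset.card_powerset, Finset.card_sdiff_of_subset hI, Finset.card_range] at card_le
  calc S.card * 2 ^ I.card ≤ 2 ^ (W - I.card) * 2 ^ I.card := Nat.mul_le_mul_right _ card_le
    _ = 2 ^ W := by rw [← pow_add, Nat.sub_add_cancel card_I_le]

lemma card_filter_add_mod (P : ℕ) [NeZero P] (t : ℕ) (p : ℕ → Prop) [DecidablePred p] :
    (Finset.univ.filter fun u : Fin P => p ((u + t) % P)).card =
      (Finset.univ.filter fun u : Fin P => p u).card := by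
  refine Finset.card_equiv (Equiv.addRight (Fin.ofNat P t)) fun u => ?_
  simp only [Finset.mem_filter, Finset.mem_univ, true_and, Equiv.coe_addRight, Fin.val_add,
    Fin.val_ofNat, Nat.add_mod_mod]

lemma pred_le_card_filter_add_mod {P h : ℕ} [NeZero P] (hP : h ≤ P) (t : ℕ) :
    h - 1 ≤ (Finset.univ.filter fun u : Fin P => 0 < (u + t) % P ∧ (u + t) % P < h).card := by
  rw [card_filter_add_mod P t fun v => 0 < v ∧ v < h, ← Nat.card_Ico]
  refine Finset.card_le_card_of_surjOn Fin.val fun v hv => ?_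
  have hv' := Finset.mem_Ico.1 hv
  exact ⟨⟨v, hv'.2.trans_le hP⟩, Finset.mem_filter.2 ⟨Finset.mem_univ _, hv'⟩, rfl⟩

lemma strictMono_add_div {P : ℕ} (hP : 0 < P) (u : ℕ) {s : ℕ → ℕ} (hs : ∀ j, s j + P ≤ s (j + 1)) :
    StrictMono fun j => (u + s j) / P := by
  refine strictMono_nat_of_lt_succ fun j => ?_
  calc (u + s j) / P < (u + s j) / P + 1 := Nat.lt_succ_self _
    _ = (u + s j + P) / P := (Nat.add_div_right _ hP).symm
    _ ≤ (u + s (j + 1)) / P :=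
      Nat.div_le_div_right (by rw [add_assoc]; exact Nat.add_le_add_left (hs j) u)

end Counting

section Superblocks

/-- The pattern which, in each pair `2 * l`, `2 * l + 1` of columns, puts exactly one spacer: in the
first column when `c l` holds and in the second otherwise. -/
def doubledPattern (c : ℕ → Bool) (i : ℕ) : Bool := if i % 2 = 0 then c (i / 2) else !c (i / 2)

lemma doubledPattern_two_mul (c : ℕ → Bool) (l : ℕ) : doubledPattern c (2 * l) = c l := by
  simp [doubledPattern]

lemma doubledPattern_two_mul_add_one (c : ℕ → Bool) (l : ℕ) :
    doubledPattern c (2 * l + 1) = !c l := by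
  have div_two : (2 * l + 1) / 2 = l := by omega
  simp [doubledPattern, div_two]

lemma sum_doubledPattern {c : ℕ → Bool} (hc : c 0 = false) {l : ℕ} (hl : 1 ≤ l) :
    ∑ j ∈ Finset.Ico 1 (2 * l), (doubledPattern c j).toNat = l := by
  induction l, hl using Nat.le_induction with
  | base => simp [doubledPattern, hc]
  | succ l hl ih =>
    rw [Nat.mul_succ, Finset.sum_Ico_succ_top (by omega), Finset.sum_Ico_succ_top (by omega), ih,
      doubledPattern_two_mul, doubledPattern_two_mul_add_one]
    cases c l <;> rfl

variable {M : ℕ → ℕ} {A : ℕ → ℕ → Bool} {n N : ℕ} {c : ℕ → Bool}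

lemma spacedHeight_succ_of_doubledPattern (hM : StrictMono M) (hA : A n = doubledPattern c)
    (hc : c 0 = false) (hN : 0 < N) (hq : 2 ^ (M (n + 1) - M n) = 2 * N) :
    spacedHeight 2 M A (n + 1) = N * (2 * spacedHeight 2 M A n + 1) := by
  rw [spacedHeight_succ hM, hq, hA, sum_doubledPattern hc hN]
  ring

lemma visitTime_superblock (hM : StrictMono M) (hA : A n = doubledPattern c)
    (hc : c 0 = false) (hq : 2 ^ (M (n + 1) - M n) = 2 * N) {l : ℕ} (hl : l < N) :
    visitTime (spacerIndices 2 M A) (2 * l * 2 ^ M n) =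
      l * (2 * spacedHeight 2 M A n + 1) + (c l).toNat := by
  rcases Nat.eq_zero_or_pos l with rfl | hl0
  · simp [visitTime, hc]
  have indicator_eq {i : ℕ} (hi : 0 < i) (hil : i ≤ 2 * l) :
      (spacerIndices 2 M A).boolIndicator (i * 2 ^ M n) = doubledPattern c i := by
    rw [boolIndicator_spacerIndices_mul_pow hM hi (by omega), hA]
  have hQ : 0 < 2 ^ M n := pow_pos two_pos _
  have hl2 : 0 < 2 * l := Nat.mul_pos two_pos hl0
  rw [visitTime_eq_orbitHeight_add (Nat.mul_pos hl2 hQ), indicator_eq hl2 le_rfl,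
    doubledPattern_two_mul, orbitHeight_mul hl2 hQ
      fun i _ r hr hrQ => mul_pow_add_mem_spacerIndices_iff hM n i hr hrQ,
    Finset.sum_congr rfl fun i hi => by
      rw [indicator_eq (Finset.mem_Ico.1 hi).1 (Finset.mem_Ico.1 hi).2.le],
    sum_doubledPattern hc hl0, spacedHeight]
  ring

lemma levelCode_superblock (hM : StrictMono M) (hA : A n = doubledPattern c) (hc : c 0 = false)
    (hq : 2 ^ (M (n + 1) - M n) = 2 * N) {m l v : ℕ} (hm : m ≤ M n) (hl : l < N) (hv0 : 0 < v)
    (hv : v < spacedHeight 2 M A n) :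
    levelCode 2 M A m (l * (2 * spacedHeight 2 M A n + 1) + v) =
      levelCode 2 M A m (v - (c l).toNat) := by
  have split : l * (2 * spacedHeight 2 M A n + 1) + v =
      visitTime (spacerIndices 2 M A) (2 * l * 2 ^ M n) + (v - (c l).toNat) := by
    rw [visitTime_superblock hM hA hc hq hl, add_assoc,
      Nat.add_sub_cancel' ((Bool.toNat_le _).trans hv0)]
  have shift_eq_zero : ((2 * l * 2 ^ M n : ℕ) : ZMod (2 ^ m)) = 0 :=
    (ZMod.natCast_eq_zero_iff _ _).2 ((pow_dvd_pow 2 hm).mul_left _)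
  rw [split, levelCode, orbit_visitTime_add
    (fun r hr hrQ => mul_pow_add_mem_spacerIndices_iff hM n (2 * l) hr hrQ) (pow_pos two_pos _)
    ((Nat.sub_le _ _).trans_lt hv), Nat.cast_add, shift_eq_zero, zero_add, levelCode]

lemma levelCode_succ_ne {p : ℕ} [Fact p.Prime] {m : ℕ} (hm : m ≠ 0) (k : ℕ) :
    levelCode p M A m (k + 1) ≠ levelCode p M A m k := by
  have : Fact (1 < p ^ m) := ⟨Nat.one_lt_pow hm (Fact.out : p.Prime).one_lt⟩
  have mem_domain := orbit_mem_skyscraperDomain (spacerIndices p M A) k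
  rw [levelCode, levelCode, orbit_succ]
  generalize orbit (spacerIndices p M A) k = x at mem_domain
  obtain ⟨r, _ | _⟩ := x
  · simp
  · simp [(Set.mem_iff_boolIndicator _ _).1 (mem_domain rfl)]

lemma eq_of_levelCode_superblock_eq (hM : StrictMono M) (hA : A n = doubledPattern c)
    (hc : c 0 = false) (hq : 2 ^ (M (n + 1) - M n) = 2 * N) {m l l' v : ℕ} (hm0 : m ≠ 0)
    (hm : m ≤ M n) (hl : l < N) (hl' : l' < N) (hv0 : 0 < v) (hv : v < spacedHeight 2 M A n)
    (h : levelCode 2 M A m (l * (2 * spacedHeight 2 M A n + 1) + v) =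
      levelCode 2 M A m (l' * (2 * spacedHeight 2 M A n + 1) + v)) : c l = c l' := by
  rw [levelCode_superblock hM hA hc hq hm hl hv0 hv,
    levelCode_superblock hM hA hc hq hm hl' hv0 hv] at h
  have ne_pred : levelCode 2 M A m v ≠ levelCode 2 M A m (v - 1) := by
    simpa only [Nat.sub_add_cancel hv0] using levelCode_succ_ne (M := M) (A := A) hm0 (v - 1)
  cases hcl : c l <;> cases hcl' : c l' <;> simp only [hcl, hcl'] at h ⊢
  exacts [absurd h ne_pred, absurd h.symm ne_pred]

end Superblocks

section Levels

variable {p : ℕ} [Fact p.Prime] {M : ℕ → ℕ} {A : ℕ → ℕ → Bool}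

lemma residueCode_iterate_of_mem_level (hM : StrictMono M) {m n k s : ℕ} (hm : m ≤ M n)
    (hks : k + s < spacedHeight p M A n) {x : ℤ_[p] × Bool}
    (hx : x ∈ (spacedOdometer p M A)^[k] '' (residueCode p (M n) ⁻¹' {(0, false)})) :
    residueCode p m ((spacedOdometer p M A)^[s] x) = levelCode p M A m (k + s) := by
  obtain ⟨⟨y, b⟩, h0, rfl⟩ := hx
  obtain ⟨hy, rfl⟩ : PadicInt.toZModPow (M n) y = 0 ∧ b = false := Prod.ext_iff.1 h0
  have hy0 : PadicInt.toZModPow m y = 0 := by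
    simpa only [Nat.cast_zero] using toZModPow_eq_natCast_of_le (a := 0) hm (by simpa using hy)
  rw [← Function.iterate_add_apply, add_comm s, iterate_spacedOdometer hM hy hks, residueCode,
    levelCode, map_add, hy0, zero_add, map_natCast]

lemma spacedMeasure_real_level (hM : StrictMono M) {n k : ℕ} (hk : k < spacedHeight p M A n) :
    (spacedMeasure p M A).real
        ((spacedOdometer p M A)^[k] '' (residueCode p (M n) ⁻¹' {(0, false)})) =
      (1 + (padicHaar p).real (spacerSet p M A))⁻¹ * ((p : ℝ) ^ M n)⁻¹ := by
  have base : {y | (y, false) ∈ residueCode p (M n) ⁻¹' {(0, false)}} =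
      PadicInt.toZModPow (M n) ⁻¹' {0} := by
    ext y; simp [residueCode]
  have no_spacer : {y | (y, true) ∈ residueCode p (M n) ⁻¹' {(0, false)}} = ∅ := by
    ext y; simp [residueCode]
  rw [← ((measurePreserving_spacedOdometer p M A).iterate k).measureReal_preimage
      (image_base (A := A) hM hk ▸ measurableSet_preimage_residueCode _).nullMeasurableSet,
    Set.preimage_image_eq _ ((spacedOdometer p M A).injective.iterate k), spacedMeasure,
    skyscraperMeasure_real_apply (measurableSet_spacerSet p M A)
      (measurableSet_preimage_residueCode _), base, no_spacer,
    padicHaar_real_preimage_toZModPow_singleton, Set.empty_inter, measureReal_empty, add_zero]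

end Levels

section WordBlocks

/-- The concatenation of all binary words of length `W`: the `b`-th word consists of the binary
digits of `b`, least significant digit first. -/
def wordBit (W l : ℕ) : Bool := (l / W).testBit (l % W)

lemma wordBit_zero (W : ℕ) : wordBit W 0 = false := by
  simp [wordBit]

lemma wordBit_mul_add {W i : ℕ} (hi : i < W) (b : ℕ) : wordBit W (b * W + i) = b.testBit i := by
  rw [wordBit, Nat.mul_add_mod_self_right, Nat.mod_eq_of_lt hi, mul_comm,
    Nat.mul_add_div (Nat.zero_lt_of_lt hi), Nat.div_eq_of_lt hi, add_zero]

/-- The position of the `u`-th level of the `o`-th superblock of the `b`-th word, for words of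
length `2 * V` and superblocks of height `P`. Only the first half of each word is used, so that
moving by at most `V` superblocks does not leave the word. -/
def wordLevel {V P : ℕ} (i : (Fin V × Fin P) × Fin (2 ^ (2 * V))) : ℕ :=
  (i.2 * (2 * V) + i.1.1) * P + i.1.2

lemma injective_wordLevel {V P : ℕ} :
    Function.Injective (wordLevel : (Fin V × Fin P) × Fin (2 ^ (2 * V)) → ℕ) := by
  have unique_digits {Q a r a' r' : ℕ} (hr : r < Q) (hr' : r' < Q)
      (h : a * Q + r = a' * Q + r') : a = a' ∧ r = r' := by
    have mod_eq := congrArg (· % Q) h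
    have div_eq := congrArg (· / Q) h
    have hQ := Nat.zero_lt_of_lt hr
    simp only [Nat.mul_add_mod_self_right, Nat.mod_eq_of_lt, hr, hr'] at mod_eq
    subst mod_eq
    exact ⟨Nat.eq_of_mul_eq_mul_right hQ (Nat.add_right_cancel h), rfl⟩
  rintro ⟨⟨o, u⟩, b⟩ ⟨⟨o', u'⟩, b'⟩ h
  obtain ⟨hbo, hu⟩ := unique_digits u.2 u'.2 h
  obtain ⟨hb, ho⟩ := unique_digits (o.2.trans_le (by omega)) (o'.2.trans_le (by omega)) hbo
  exact Prod.ext (Prod.ext (Fin.ext ho) (Fin.ext hu)) (Fin.ext hb)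

lemma wordLevel_add {V P : ℕ} (o : Fin V) (u : Fin P) (b : Fin (2 ^ (2 * V))) (s : ℕ) :
    wordLevel ((o, u), b) + s = (b * (2 * V) + (o + (u + s) / P)) * P + (u + s) % P := by
  calc (b * (2 * V) + o) * P + u + s
      = (b * (2 * V) + o) * P + (P * ((u + s) / P) + (u + s) % P) := by
        rw [Nat.div_add_mod, add_assoc]
    _ = (b * (2 * V) + (o + (u + s) / P)) * P + (u + s) % P := by ring

lemma add_div_lt_two_mul {V P s : ℕ} (o : Fin V) (u : Fin P) (hs : s ≤ V * P) :
    (o : ℕ) + (u + s) / P < 2 * V := by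
  have div_lt : ((u : ℕ) + s) / P < V + 1 := by
    rw [Nat.div_lt_iff_lt_mul (Nat.zero_lt_of_lt u.2), Nat.succ_mul, add_comm]
    exact add_lt_add_of_le_of_lt hs u.2
  have := o.2
  omega

lemma mul_add_lt_mul_two_pow {W i : ℕ} (b : Fin (2 ^ W)) (hi : i < W) : b * W + i < W * 2 ^ W :=
  calc b * W + i < b * W + W := Nat.add_lt_add_left hi _
    _ = W * (b + 1) := by ring
    _ ≤ W * 2 ^ W := Nat.mul_le_mul_left _ b.2

lemma wordLevel_add_lt {V P s : ℕ} (i : (Fin V × Fin P) × Fin (2 ^ (2 * V))) (hs : s ≤ V * P) :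
    wordLevel i + s < 2 * V * 2 ^ (2 * V) * P := by
  obtain ⟨⟨o, u⟩, b⟩ := i
  rw [wordLevel_add]
  calc (b * (2 * V) + (o + (u + s) / P)) * P + (u + s) % P
      < (b * (2 * V) + (o + (u + s) / P)) * P + P :=
        Nat.add_lt_add_left (Nat.mod_lt _ (Nat.zero_lt_of_lt u.2)) _
    _ = (b * (2 * V) + (o + (u + s) / P) + 1) * P := (Nat.succ_mul _ _).symm
    _ ≤ 2 * V * 2 ^ (2 * V) * P :=
        Nat.mul_le_mul_right _ (mul_add_lt_mul_two_pow b (add_div_lt_two_mul o u hs))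

/-- The indices `j < K` for which the time `s j` reaches, from the `u`-th level of a superblock of
height `2 * h + 1`, a level among those whose code reveals the position of the spacer. -/
def revealingTimes (h u : ℕ) (s : ℕ → ℕ) (K : ℕ) : Finset ℕ :=
  (Finset.range K).filter fun j => 0 < (u + s j) % (2 * h + 1) ∧ (u + s j) % (2 * h + 1) < h

lemma mul_pred_le_sum_card_revealingTimes (h : ℕ) (s : ℕ → ℕ) (K : ℕ) :
    K * (h - 1) ≤ ∑ u : Fin (2 * h + 1), (revealingTimes h u s K).card := by
  simp only [revealingTimes, Finset.card_filter]
  rw [Finset.sum_comm]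
  simp only [← Finset.card_filter]
  calc K * (h - 1) = ∑ _j ∈ Finset.range K, (h - 1) := by
        rw [Finset.sum_const, Finset.card_range, smul_eq_mul]
    _ ≤ _ := Finset.sum_le_sum fun j _ => pred_le_card_filter_add_mod (by omega) (s j)

variable {M : ℕ → ℕ} {A : ℕ → ℕ → Bool} {n V : ℕ}

lemma testBit_eq_of_levelCode_wordLevel_eq (hM : StrictMono M) (hn : 0 < M n)
    (hA : A n = doubledPattern (wordBit (2 * V)))
    (hq : 2 ^ (M (n + 1) - M n) = 2 * (2 * V * 2 ^ (2 * V))) {o : Fin V}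
    {u : Fin (2 * spacedHeight 2 M A n + 1)} {b b' : Fin (2 ^ (2 * V))} {s : ℕ}
    (hs : s ≤ V * (2 * spacedHeight 2 M A n + 1))
    (h0 : 0 < (u + s) % (2 * spacedHeight 2 M A n + 1))
    (hlt : (u + s) % (2 * spacedHeight 2 M A n + 1) < spacedHeight 2 M A n)
    (h : levelCode 2 M A 1 (wordLevel ((o, u), b) + s) =
      levelCode 2 M A 1 (wordLevel ((o, u), b') + s)) :
    (b : ℕ).testBit (o + (u + s) / (2 * spacedHeight 2 M A n + 1)) =
      (b' : ℕ).testBit (o + (u + s) / (2 * spacedHeight 2 M A n + 1)) := by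
  have offset_lt := add_div_lt_two_mul o u hs
  rw [wordLevel_add, wordLevel_add] at h
  rw [← wordBit_mul_add offset_lt, ← wordBit_mul_add offset_lt]
  exact eq_of_levelCode_superblock_eq hM hA (wordBit_zero _) hq one_ne_zero hn
    (mul_add_lt_mul_two_pow b offset_lt) (mul_add_lt_mul_two_pow b' offset_lt) h0 hlt h

lemma card_filter_mul_two_pow_card_revealingTimes_le (hM : StrictMono M) (hn : 0 < M n)
    (hA : A n = doubledPattern (wordBit (2 * V)))
    (hq : 2 ^ (M (n + 1) - M n) = 2 * (2 * V * 2 ^ (2 * V))) {o : Fin V}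
    {u : Fin (2 * spacedHeight 2 M A n + 1)} {s : ℕ → ℕ} {K : ℕ}
    (hgap : ∀ j, s j + (2 * spacedHeight 2 M A n + 1) ≤ s (j + 1))
    (hs : ∀ j < K, s j ≤ V * (2 * spacedHeight 2 M A n + 1)) {S : Finset (Fin (2 ^ (2 * V)))}
    (hS : ∀ b ∈ S, ∀ b' ∈ S, ∀ j < K, levelCode 2 M A 1 (wordLevel ((o, u), b) + s j) =
      levelCode 2 M A 1 (wordLevel ((o, u), b') + s j)) :
    S.card * 2 ^ (revealingTimes (spacedHeight 2 M A n) u s K).card ≤ 2 ^ (2 * V) := by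
  have injective_bit : Function.Injective
      fun j => (o : ℕ) + (u + s j) / (2 * spacedHeight 2 M A n + 1) := fun i j hij =>
    (strictMono_add_div (Nat.succ_pos _) u hgap).injective (Nat.add_left_cancel hij)
  rw [← Finset.card_image_of_injective _ injective_bit]
  refine card_mul_two_pow_card_le_of_testBit_eq (Finset.image_subset_iff.2 fun j hj => ?_)
    fun b hb b' hb' i hi => ?_
  · have hjK := Finset.mem_range.1 (Finset.mem_filter.1 hj).1
    exact Finset.mem_range.2 (add_div_lt_two_mul o u (hs j hjK))
  · obtain ⟨j, hj, rfl⟩ := Finset.mem_image.1 hi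
    obtain ⟨hjK, h0, hlt⟩ := Finset.mem_filter.1 hj
    have hjK := Finset.mem_range.1 hjK
    exact testBit_eq_of_levelCode_wordLevel_eq hM hn hA hq (hs j hjK) h0 hlt (hS b hb b' hb' j hjK)

lemma mul_le_sum_card_revealingTimes {h : ℕ} (h1 : 1 ≤ h) (s : ℕ → ℕ) (V K : ℕ) :
    V * (K * (h - 1) : ℝ) ≤
      ∑ j : Fin V × Fin (2 * h + 1), ((revealingTimes h j.2 s K).card : ℝ) := by
  simp only [Fintype.sum_prod_type, Finset.sum_const, Finset.card_univ, Fintype.card_fin,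
    nsmul_eq_mul]
  refine mul_le_mul_of_nonneg_left ?_ V.cast_nonneg
  rw [← Nat.cast_one, ← Nat.cast_sub h1]
  exact mod_cast mul_pred_le_sum_card_revealingTimes h s K

lemma mul_log_two_le_partitionEntropy (hM : StrictMono M) (hn : 0 < M n)
    (hA : A n = doubledPattern (wordBit (2 * V)))
    (hq : 2 ^ (M (n + 1) - M n) = 2 * (2 * V * 2 ^ (2 * V))) (hV : 0 < V) {t : ℕ → ℕ}
    (ht : Monotone t) {K : ℕ}
    (hgap : ∀ k ≥ K, t k + (2 * spacedHeight 2 M A n + 1) ≤ t (k + 4))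
    (hbound : t (5 * K) ≤ V * (2 * spacedHeight 2 M A n + 1)) :
    (1 + (padicHaar 2).real (spacerSet 2 M A))⁻¹ * (2 ^ M (n + 1))⁻¹ * 2 ^ (2 * V) * Real.log 2 *
        (V * (K * (spacedHeight 2 M A n - 1))) ≤
      partitionEntropy (spacedMeasure 2 M A)
        (sequenceCoding (spacedOdometer 2 M A) t (residueCode 2 1) (5 * K)) := by
  classical
  have hn1 : 0 < M (n + 1) := hn.trans (hM n.lt_succ_self)
  have height_succ : spacedHeight 2 M A (n + 1) =
      2 * V * 2 ^ (2 * V) * (2 * spacedHeight 2 M A n + 1) :=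
    spacedHeight_succ_of_doubledPattern hM hA (wordBit_zero _) (by positivity) hq
  have level_lt {s : ℕ} (hs : s ≤ t (5 * K)) (i) : wordLevel i + s < spacedHeight 2 M A (n + 1) :=
    height_succ ▸ wordLevel_add_lt i (hs.trans hbound)
  have wordLevel_lt (i) : wordLevel i < spacedHeight 2 M A (n + 1) := level_lt (Nat.zero_le _) i
  have entropy := mul_log_two_mul_sum_le_partitionEntropy (μ := spacedMeasure 2 M A)
    (measurableSet_preimage_sequenceCoding (t := t) (n := 5 * K) (spacedOdometer 2 M A).measurable
      fun c => measurableSet_preimage_residueCode (m := 1) {c})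
    (fun i => image_base (A := A) hM (wordLevel_lt i) ▸ measurableSet_preimage_residueCode _)
    (fun i i' hii => disjoint_levels_spacedOdometer hM (wordLevel_lt i) (wordLevel_lt i')
      (injective_wordLevel.ne hii))
    (by positivity) (fun i => spacedMeasure_real_level hM (wordLevel_lt i))
    (w := fun j b (k : Fin (5 * K)) => levelCode 2 M A 1 (wordLevel (j, b) + t (k + 1)))
    (D := fun j => (revealingTimes (spacedHeight 2 M A n) j.2 (fun i => t (K + 4 * i)) K).card)
    (fun j b x hx => funext fun k =>
      residueCode_iterate_of_mem_level hM hn1 (level_lt (ht k.2) (j, b)) hx)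
    fun ⟨o, u⟩ c => ?_
  · rw [Fintype.card_fin, Nat.cast_pow, Nat.cast_ofNat] at entropy
    refine (mul_le_mul_of_nonneg_left ?_ (by positivity)).trans entropy
    exact mul_le_sum_card_revealingTimes (Nat.succ_pos _) _ _ _
  · rw [Fintype.card_fin]
    refine card_filter_mul_two_pow_card_revealingTimes_le hM hn hA hq (o := o)
      (fun j => hgap (K + 4 * j) (by omega)) (fun j hj => (ht (by omega)).trans hbound)
      fun b hb b' hb' j hj => ?_
    have hj' : K + 4 * j - 1 < 5 * K := by omega
    have code_eq := congrFun ((Finset.mem_filter.1 hb).2.trans (Finset.mem_filter.1 hb').2.symm)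
      ⟨K + 4 * j - 1, hj'⟩
    simpa only [Nat.sub_add_cancel (show 1 ≤ K + 4 * j by omega)] using code_eq

lemma mul_log_two_div_le_partitionEntropy (hM : StrictMono M) (hn : 0 < M n)
    (hA : A n = doubledPattern (wordBit (2 * V)))
    (hq : 2 ^ (M (n + 1) - M n) = 2 * (2 * V * 2 ^ (2 * V))) (hV : 0 < V) {t : ℕ → ℕ}
    (ht : Monotone t) {K : ℕ}
    (hgap : ∀ k ≥ K, t k + (2 * spacedHeight 2 M A n + 1) ≤ t (k + 4))
    (hbound : t (5 * K) ≤ V * (2 * spacedHeight 2 M A n + 1)) :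
    K * Real.log 2 / 16 ≤ partitionEntropy (spacedMeasure 2 M A)
      (sequenceCoding (spacedOdometer 2 M A) t (residueCode 2 1) (5 * K)) := by
  refine le_trans ?_ (mul_log_two_le_partitionEntropy hM hn hA hq hV ht hgap hbound)
  have spacer_le : 1 + (padicHaar 2).real (spacerSet 2 M A) ≤ 2 := by
    linarith [measureReal_le_one (μ := padicHaar 2) (s := spacerSet 2 M A)]
  have pow_succ_eq : (2 : ℝ) ^ M (n + 1) = 4 * V * 2 ^ (2 * V) * 2 ^ M n := by
    rw [← Nat.sub_add_cancel (hM n.lt_succ_self).le, pow_add]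
    have := congrArg (Nat.cast : ℕ → ℝ) hq
    push_cast at this
    rw [this]
    ring
  have pow_le_height : (2 : ℝ) ^ M n ≤ spacedHeight 2 M A n :=
    mod_cast le_orbitHeight (spacerIndices 2 M A) (2 ^ M n)
  have two_le_pow : (2 : ℝ) ≤ 2 ^ M n := le_self_pow₀ one_le_two hn.ne'
  have half_le : (2 : ℝ)⁻¹ ≤ (2 ^ M n)⁻¹ * (spacedHeight 2 M A n - 1) := by
    rw [inv_mul_eq_div, le_div_iff₀ (by positivity)]
    linarith
  calc K * Real.log 2 / 16
      = 2⁻¹ * (K * Real.log 2 / 4 * 2⁻¹) := by ring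
    _ ≤ (1 + (padicHaar 2).real (spacerSet 2 M A))⁻¹ *
          (K * Real.log 2 / 4 * ((2 ^ M n)⁻¹ * (spacedHeight 2 M A n - 1))) := by
        gcongr
    _ = _ := by
        have V_ne_zero : (V : ℝ) ≠ 0 := mod_cast hV.ne'
        rw [pow_succ_eq]
        field_simp [V_ne_zero]

end WordBlocks

section Construction

variable (v : ℕ → ℕ)

/-- The stages of the construction in which a tower of height `h` is cut according to the words
of length `2 * 2 ^ v h`: the `n`-th entry consists of the exponent `M n` for which the `n`-th base
is a coset of `2 ^ M n`, and of the height of the `n`-th tower. -/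
def stage : ℕ → ℕ × ℕ
  | 0 => (0, 1)
  | n + 1 => ((stage n).1 + (1 + (v (stage n).2 + 1) + 2 * 2 ^ v (stage n).2),
      2 * 2 ^ v (stage n).2 * 2 ^ (2 * 2 ^ v (stage n).2) * (2 * (stage n).2 + 1))

/-- The exponents of the cosets serving as bases of the towers. -/
def stageExponent (n : ℕ) : ℕ := (stage v n).1

/-- The spacer patterns of the construction. -/
def stagePattern (n : ℕ) : ℕ → Bool := doubledPattern (wordBit (2 * 2 ^ v (stage v n).2))

/-- The height of the `n`-th tower of the construction. -/
def stageHeight (n : ℕ) : ℕ := spacedHeight 2 (stageExponent v) (stagePattern v) n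

lemma strictMono_stageExponent : StrictMono (stageExponent v) :=
  strictMono_nat_of_lt_succ fun n => by simp only [stageExponent, stage]; omega

lemma stageHeight_pos (n : ℕ) : 0 < stageHeight v n := Nat.succ_pos _

lemma two_pow_stageExponent_succ_sub_of_stage (n : ℕ) :
    2 ^ (stageExponent v (n + 1) - stageExponent v n) =
      2 * (2 * 2 ^ v (stage v n).2 * 2 ^ (2 * 2 ^ v (stage v n).2)) := by
  simp only [stageExponent, stage, Nat.add_sub_cancel_left]
  rw [pow_add, pow_add, pow_add, pow_one]
  ring

lemma stageHeight_eq_stage (n : ℕ) : stageHeight v n = (stage v n).2 := by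
  induction n with
  | zero => simp [stageHeight, spacedHeight, stageExponent, stage, orbitHeight, visitTime]
  | succ n ih =>
    rw [stageHeight, spacedHeight_succ_of_doubledPattern (strictMono_stageExponent v) rfl
      (wordBit_zero _) (by positivity) (two_pow_stageExponent_succ_sub_of_stage v n),
      ← stageHeight, ih, stage]

lemma stagePattern_eq (n : ℕ) :
    stagePattern v n = doubledPattern (wordBit (2 * 2 ^ v (stageHeight v n))) := by
  rw [stagePattern, stageHeight_eq_stage]

lemma two_pow_stageExponent_succ_sub (n : ℕ) :
    2 ^ (stageExponent v (n + 1) - stageExponent v n) =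
      2 * (2 * 2 ^ v (stageHeight v n) * 2 ^ (2 * 2 ^ v (stageHeight v n))) := by
  rw [two_pow_stageExponent_succ_sub_of_stage, stageHeight_eq_stage]

lemma stageHeight_succ (n : ℕ) :
    stageHeight v (n + 1) = 2 * 2 ^ v (stageHeight v n) *
      2 ^ (2 * 2 ^ v (stageHeight v n)) * (2 * stageHeight v n + 1) := by
  rw [stageHeight_eq_stage, stageHeight_eq_stage, stage]

lemma tendsto_stageHeight : Tendsto (stageHeight v) atTop atTop :=
  tendsto_atTop_mono (fun n => calc
    n ≤ stageExponent v n := (strictMono_stageExponent v).le_apply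
    _ ≤ 2 ^ stageExponent v n := Nat.lt_two_pow_self.le
    _ ≤ stageHeight v n := le_orbitHeight _ _) tendsto_id

lemma log_stageHeight_succ_le (n : ℕ) : Real.log (stageHeight v (n + 1)) ≤
    4 * 2 ^ v (stageHeight v n) + 2 + Real.log (stageHeight v n) := by
  rw [stageHeight_succ]
  have one_le_height : (1 : ℝ) ≤ stageHeight v n := mod_cast stageHeight_pos v n
  generalize (stageHeight v n : ℕ) = h at *
  have log_words : Real.log (2 * 2 ^ v h) ≤ 2 * 2 ^ v h :=
    Real.log_le_self (by positivity)
  have log_pow_words : ((2 * 2 ^ v h : ℕ) : ℝ) * Real.log 2 ≤ 2 * 2 ^ v h := by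
    push_cast
    exact mul_le_of_le_one_right (by positivity) (by linarith [Real.log_two_lt_d9])
  have log_superblock : Real.log (2 * h + 1) ≤ 2 + Real.log h := by
    calc Real.log (2 * h + 1) ≤ Real.log (3 * h) :=
          Real.log_le_log (by positivity) (by linarith)
      _ = Real.log 3 + Real.log h := Real.log_mul (by norm_num) (by positivity)
      _ ≤ 2 + Real.log h := by
        linarith [Real.log_le_sub_one_of_pos (show (0 : ℝ) < 3 by norm_num)]
  push_cast
  rw [Real.log_mul (by positivity) (by positivity), Real.log_mul (by positivity) (by positivity),
    Real.log_pow]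
  linarith

lemma sequenceEntropy_spacedOdometer_pos {t : ℕ → ℕ} (ht : Monotone t) {K : ℕ → ℕ}
    (hK : Tendsto K atTop atTop) (hgap : ∀ h ≥ 1, ∀ k ≥ K h, t k + (2 * h + 1) ≤ t (k + 4))
    (hbound : ∀ h ≥ 1, t (5 * K h) ≤ 2 ^ v h * (2 * h + 1)) :
    0 < sequenceEntropy (spacedMeasure 2 (stageExponent v) (stagePattern v))
      (spacedOdometer 2 (stageExponent v) (stagePattern v)) t := by
  have tendsto_length : Tendsto (fun n => 5 * K (stageHeight v n)) atTop atTop :=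
    Tendsto.const_mul_atTop' (by norm_num) (hK.comp (tendsto_stageHeight v))
  have entropy_rate_pos : (0 : EReal) < (Real.log 2 / 80 : ℝ) :=
    EReal.coe_pos.2 (div_pos (Real.log_pos one_lt_two) (by norm_num))
  refine entropy_rate_pos.trans_le ((le_sequenceEntropyPartition_of_frequently
    (tendsto_length.frequently (Eventually.frequently ?_))).trans
      (sequenceEntropyPartition_le_sequenceEntropy (φ := residueCode 2 1)
        fun c => measurableSet_preimage_residueCode {c}))
  filter_upwards [eventually_ge_atTop 1] with n hn
  calc Real.log 2 / 80 * (5 * K (stageHeight v n) : ℕ) = K (stageHeight v n) * Real.log 2 / 16 := by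
        push_cast
        ring
    _ ≤ _ := mul_log_two_div_le_partitionEntropy (strictMono_stageExponent v)
      (hn.trans (strictMono_stageExponent v).le_apply) (stagePattern_eq v n)
      (mod_cast two_pow_stageExponent_succ_sub v n) (by positivity) ht
      (hgap _ (stageHeight_pos v n)) (hbound _ (stageHeight_pos v n))

/-- Some rank one system has positive sequence entropy along `t`, and tower heights `h` with
`log h_{n+1} = O(Φ(h_n))`. -/
def RealizedByRankOne (t : ℕ → ℕ) (Φ : ℕ → ℝ) : Prop :=
  ∃ (X : Type) (_ : MeasurableSpace X) (_ : StandardBorelSpace X) (μ : Measure X)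
    (T : X ≃ᵐ X) (h : ℕ → ℕ), IsRankOneSystem μ T h ∧ 0 < sequenceEntropy μ T t ∧
      limsup (fun n => ((Real.log (h (n + 1)) / Φ (h n) : ℝ) : EReal)) atTop < ⊤

theorem realizedByRankOne_of_gap {t : ℕ → ℕ} (ht : Monotone t) {K : ℕ → ℕ}
    (hK : Tendsto K atTop atTop) (hgap : ∀ h ≥ 1, ∀ k ≥ K h, t k + (2 * h + 1) ≤ t (k + 4))
    {C : ℕ} (hbound : ∀ h ≥ 1, t (5 * K h) ≤ C * K h * h) {Φ : ℕ → ℝ} {c d : ℝ}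
    (hΦ : ∀ h ≥ 1, 1 ≤ Φ h) (hKΦ : ∀ h ≥ 1, K h ≤ c * Φ h)
    (hlog : ∀ h : ℕ, 1 ≤ h → Real.log h ≤ d * Φ h) : RealizedByRankOne t Φ := by
  let v (h : ℕ) : ℕ := Nat.log 2 (C * K h + 1) + 1
  have lt_two_pow (h : ℕ) : C * K h + 1 < 2 ^ v h := Nat.lt_pow_succ_log_self one_lt_two _
  have two_pow_le (h : ℕ) : (2 : ℝ) ^ v h ≤ 2 * (C * K h + 1) := by
    rw [pow_succ']
    exact mod_cast Nat.mul_le_mul_left 2 (Nat.pow_log_le_self 2 (Nat.succ_ne_zero _))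
  refine ⟨ℤ_[2] × Bool, inferInstance, inferInstance, _, _, stageHeight v,
    isRankOneSystem_spacedOdometer (strictMono_stageExponent v) rfl,
    sequenceEntropy_spacedOdometer_pos v ht hK hgap fun h hh => (hbound h hh).trans
      (Nat.mul_le_mul ((Nat.le_succ _).trans (lt_two_pow h).le) (by omega)),
    (limsup_le_of_le (h := Eventually.of_forall fun n => ?_)).trans_lt
      (EReal.coe_lt_top (8 * C * c + 10 + d))⟩
  have height_pos := stageHeight_pos v n
  have one_le_Φ := hΦ _ height_pos
  rw [EReal.coe_le_coe_iff, div_le_iff₀ (by linarith)]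
  calc Real.log (stageHeight v (n + 1))
      ≤ 4 * 2 ^ v (stageHeight v n) + 2 + Real.log (stageHeight v n) :=
        log_stageHeight_succ_le v n
    _ ≤ 4 * (2 * (C * K (stageHeight v n) + 1)) + 2 + Real.log (stageHeight v n) := by
        gcongr
        exact two_pow_le _
    _ = 8 * C * K (stageHeight v n) + 10 * 1 + Real.log (stageHeight v n) := by ring
    _ ≤ 8 * C * (c * Φ (stageHeight v n)) + 10 * Φ (stageHeight v n) +
          d * Φ (stageHeight v n) := by
        gcongr
        exacts [hKΦ _ height_pos, hlog _ height_pos]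
    _ = _ := by ring

end Construction

section Floor

lemma monotone_floor_natCast_mul {g : ℝ → ℝ} (hg0 : ∀ x, 1 ≤ x → 0 ≤ g x)
    (hg : MonotoneOn g (Set.Ici 1)) : Monotone fun k : ℕ => ⌊k * g k⌋₊ := by
  intro k l hkl
  rcases k.eq_zero_or_pos with rfl | hk
  · simp
  · have one_le : (1 : ℝ) ≤ k := mod_cast hk
    have cast_le : (k : ℝ) ≤ l := mod_cast hkl
    exact Nat.floor_le_floor (mul_le_mul cast_le (hg one_le (one_le.trans cast_le) cast_le)
      (hg0 _ one_le) l.cast_nonneg)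

lemma floor_natCast_mul_add_le {g : ℝ → ℝ} (hg : MonotoneOn g (Set.Ici 1)) {h k : ℕ} (hh : 1 ≤ h)
    (hk : (1 : ℝ) ≤ k) (hhg : h ≤ g k) :
    ⌊k * g k⌋₊ + (2 * h + 1) ≤ ⌊(k + 4 : ℕ) * g (k + 4 : ℕ)⌋₊ := by
  have g_le : g k ≤ g (k + 4) := hg hk (le_add_of_le_of_nonneg hk zero_le_four) (by simp)
  have g_nonneg : 0 ≤ g k := h.cast_nonneg.trans hhg
  calc ⌊k * g k⌋₊ + (2 * h + 1) ≤ ⌊k * g k⌋₊ + 4 * h := by omega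
    _ = ⌊k * g k + (4 * h : ℕ)⌋₊ :=
      (Nat.floor_add_natCast (mul_nonneg k.cast_nonneg g_nonneg) _).symm
    _ ≤ _ := Nat.floor_le_floor ?_
  push_cast
  calc k * g k + 4 * h ≤ k * g k + 4 * g k := by gcongr
    _ = (k + 4) * g k := by ring
    _ ≤ (k + 4) * g (k + 4) := by gcongr

theorem realizedByRankOne_floor_mul {g : ℝ → ℝ} (hg0 : ∀ x, 1 ≤ x → 0 ≤ g x)
    (hg : MonotoneOn g (Set.Ici 1)) {G Φ : ℕ → ℝ} {c d : ℝ} (hG : Tendsto G atTop atTop)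
    (hG1 : ∀ h ≥ 1, 1 ≤ G h) (hGg : ∀ h : ℕ, 1 ≤ h → h ≤ g (G h))
    (hgG : ∀ h : ℕ, 1 ≤ h → g (10 * G h) ≤ c * h) (hGΦ : ∀ h ≥ 1, G h ≤ Φ h)
    (hlog : ∀ h : ℕ, 1 ≤ h → Real.log h ≤ d * Φ h) :
    RealizedByRankOne (fun k => ⌊k * g k⌋₊) Φ := by
  have ceil_le (h : ℕ) (hh : 1 ≤ h) : (⌈G h⌉₊ : ℝ) ≤ 2 * G h :=
    Nat.ceil_le_two_mul (by linarith [hG1 h hh])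
  refine realizedByRankOne_of_gap (K := fun h => ⌈G h⌉₊) (monotone_floor_natCast_mul hg0 hg)
    (tendsto_nat_ceil_atTop.comp hG) (fun h hh k hk => ?_) (C := ⌈5 * c⌉₊)
    (fun h hh => Nat.floor_le_of_le ?_) (fun h hh => (hG1 h hh).trans (hGΦ h hh))
    (fun h hh => (ceil_le h hh).trans (mul_le_mul_of_nonneg_left (hGΦ h hh) zero_le_two)) hlog
  · have G_le : G h ≤ k := Nat.ceil_le.1 hk
    have one_le : (1 : ℝ) ≤ k := (hG1 h hh).trans G_le
    exact floor_natCast_mul_add_le hg hh one_le ((hGg h hh).trans (hg (hG1 h hh) one_le G_le))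
  · push_cast
    have le_ten_mul : 5 * (⌈G h⌉₊ : ℝ) ≤ 10 * G h := by linarith [ceil_le h hh]
    have one_le : 1 ≤ 5 * (⌈G h⌉₊ : ℝ) := by linarith [hG1 h hh, Nat.le_ceil (G h)]
    calc 5 * (⌈G h⌉₊ : ℝ) * g (5 * ⌈G h⌉₊) ≤ 5 * ⌈G h⌉₊ * (c * h) := by
          gcongr
          exact (hg one_le (one_le.trans le_ten_mul) le_ten_mul).trans (hgG h hh)
      _ = 5 * c * (⌈G h⌉₊ * h) := by ring
      _ ≤ ⌈5 * c⌉₊ * (⌈G h⌉₊ * h) := by gcongr; exact Nat.le_ceil _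
      _ = _ := by ring

lemma log_natCast_le_one_div_mul_rpow (h : ℕ) {β : ℝ} (hβ : 0 < β) :
    Real.log h ≤ 1 / β * (h : ℝ) ^ β := by
  rw [one_div_mul_eq_div]
  exact Real.log_le_rpow_div h.cast_nonneg hβ

theorem realizedByRankOne_floor_rpow {α β : ℝ} (hβ : 0 < β) (h : 1 + 1 / β ≤ α) :
    RealizedByRankOne (fun n => ⌊(n : ℝ) ^ α⌋₊) fun h => (h : ℝ) ^ β := by
  obtain ⟨γ, rfl⟩ : ∃ γ, α = 1 + γ := ⟨α - 1, by ring⟩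
  have hγβ : 1 / β ≤ γ := le_of_add_le_add_left h
  have hγ : 0 < γ := (one_div_pos.2 hβ).trans_le hγβ
  have rpow_eq : (fun n : ℕ => ⌊(n : ℝ) ^ (1 + γ)⌋₊) = fun n : ℕ => ⌊(n : ℝ) * (n : ℝ) ^ γ⌋₊ := by
    simp only [Real.rpow_one_add' (Nat.cast_nonneg _) (show 1 + γ ≠ 0 by positivity)]
  rw [rpow_eq]
  refine realizedByRankOne_floor_mul (g := fun x => x ^ γ) (G := fun h => (h : ℝ) ^ γ⁻¹)
    (c := 10 ^ γ) (fun x hx => by positivity)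
    ((Real.monotoneOn_rpow_Ici_of_exponent_nonneg hγ.le).mono
      (Set.Ici_subset_Ici.2 zero_le_one))
    ((tendsto_rpow_atTop (inv_pos.2 hγ)).comp tendsto_natCast_atTop_atTop)
    (fun h hh => Real.one_le_rpow (mod_cast hh) (inv_pos.2 hγ).le)
    (fun h _ => (Real.rpow_inv_rpow h.cast_nonneg hγ.ne').ge) (fun h _ => ?_)
    (fun h hh => Real.rpow_le_rpow_of_exponent_le (mod_cast hh)
      (by rwa [inv_le_comm₀ hγ hβ, ← one_div]))
    fun h _ => log_natCast_le_one_div_mul_rpow h hβ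
  rw [Real.mul_rpow (by norm_num) (by positivity), Real.rpow_inv_rpow h.cast_nonneg hγ.ne']

theorem realizedByRankOne_floor_mul_log_rpow {α β : ℝ} (hβ : 0 < β) (h : 1 / β ≤ α) :
    RealizedByRankOne (fun n => ⌊(n : ℝ) * Real.log n ^ α⌋₊)
      fun h => Real.exp ((h : ℝ) ^ β) := by
  have hα : 0 < α := (one_div_pos.2 hβ).trans_le h
  refine realizedByRankOne_floor_mul (g := fun x => Real.log x ^ α)
    (G := fun h => Real.exp ((h : ℝ) ^ α⁻¹)) (c := (Real.log 10 + 1) ^ α) (d := 1 / β)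
    (fun x hx => Real.rpow_nonneg (Real.log_nonneg hx) _)
    (fun x hx y _ hxy => Real.rpow_le_rpow (Real.log_nonneg hx)
      (Real.log_le_log (zero_lt_one.trans_le hx) hxy) hα.le)
    (Real.tendsto_exp_atTop.comp
      ((tendsto_rpow_atTop (inv_pos.2 hα)).comp tendsto_natCast_atTop_atTop))
    (fun h _ => Real.one_le_exp (by positivity)) (fun h _ => ?_) (fun h hh => ?_)
    (fun h hh => Real.exp_le_exp.2 (Real.rpow_le_rpow_of_exponent_le (mod_cast hh)
      (by rwa [inv_le_comm₀ hα hβ, ← one_div])))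
    fun h _ => ?_
  · rw [Real.log_exp, Real.rpow_inv_rpow h.cast_nonneg hα.ne']
  · have one_le_rpow : (1 : ℝ) ≤ (h : ℝ) ^ α⁻¹ :=
      Real.one_le_rpow (mod_cast hh) (inv_pos.2 hα).le
    have log_ten_pos : 0 < Real.log 10 := Real.log_pos (by norm_num)
    calc Real.log (10 * Real.exp ((h : ℝ) ^ α⁻¹)) ^ α
        = (Real.log 10 + (h : ℝ) ^ α⁻¹) ^ α := by
          rw [Real.log_mul (by norm_num) (Real.exp_ne_zero _), Real.log_exp]
      _ ≤ ((Real.log 10 + 1) * (h : ℝ) ^ α⁻¹) ^ α := by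
          gcongr
          linarith [le_mul_of_one_le_right log_ten_pos.le one_le_rpow]
      _ = (Real.log 10 + 1) ^ α * h := by
          rw [Real.mul_rpow (by positivity) (by positivity),
            Real.rpow_inv_rpow h.cast_nonneg hα.ne']
  · calc Real.log h ≤ 1 / β * (h : ℝ) ^ β := log_natCast_le_one_div_mul_rpow h hβ
      _ ≤ 1 / β * Real.exp ((h : ℝ) ^ β) := by
        gcongr
        linarith [Real.add_one_le_exp ((h : ℝ) ^ β)]

end Floor

end

end PadicSkyscraper

theorem mainTheorem4 :
    (∀ α β : ℝ, 0 < α → 0 < β → 1 + 1 / β ≤ α →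
      ∃ (X : Type) (_ : MeasurableSpace X) (_ : StandardBorelSpace X) (μ : Measure X)
        (T : X ≃ᵐ X) (h : ℕ → ℕ),
        IsRankOneSystem μ T h ∧
        0 < sequenceEntropy μ T (fun n : ℕ => ⌊(n : ℝ) ^ α⌋₊) ∧
        limsup (fun n : ℕ =>
          ((Real.log (h (n + 1) : ℝ) / (h n : ℝ) ^ β : ℝ) : EReal)) atTop < ⊤) ∧
    (∀ α β : ℝ, 0 < α → 0 < β → 1 / β ≤ α →
      ∃ (X : Type) (_ : MeasurableSpace X) (_ : StandardBorelSpace X) (μ : Measure X)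
        (T : X ≃ᵐ X) (h : ℕ → ℕ),
        IsRankOneSystem μ T h ∧
        0 < sequenceEntropy μ T (fun n : ℕ => ⌊(n : ℝ) * Real.log (n : ℝ) ^ α⌋₊) ∧
        limsup (fun n : ℕ =>
          ((Real.log (h (n + 1) : ℝ) / Real.exp ((h n : ℝ) ^ β) : ℝ) : EReal)) atTop < ⊤) :=
  ⟨fun _ _ _ hβ h => PadicSkyscraper.realizedByRankOne_floor_rpow hβ h,
    fun _ _ _ hβ h => PadicSkyscraper.realizedByRankOne_floor_mul_log_rpow hβ h⟩
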